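/- \textbf{Theorem (Combining additive codes).} Let $q$ be a power of a prime $p$ and write $\bar x=x^q$ on $\mathbb F_{q^2}$. Fix $\beta\in\mathbb F_{q^2}$ such that $\{\beta,\beta^q\}$ is a basis of $\mathbb F_{q^2}$ over $\mathbb F_q$, and put $\gamma=(\beta^2-\beta^{2q})^{-1}$. For $u,v\in\mathbb F_{q^2}^N$ let $$(u,v)_t=\mathrm{tr}_{\mathbb F_{q^2}/\mathbb F_p}\Big(\gamma\sum_j u_j\bar v_j\Big),$$ let $\mathcal C^{\perp_t}=\{u:(u,v)_t=0\ \forall v\in\mathcal C\}$ be the trace dual of an additive code (additive subgroup) $\mathcal C\subseteq\mathbb F_{q^2}^N$, and call $\mathcal C$ ACD if $\mathcal C\cap\mathcal C^{\perp_t}=\{0\}$. (If $q$ is even, one may take $\beta+\beta^q=1$, and then $\gamma=1$.) The map $\phi(a|b)=\beta a+\beta^q b$ is an isometry from $\mathbb F_q^{2N}$ with the form $\mathrm{tr}_{\mathbb F_q/\mathbb F_p}(a\cdot b'-b\cdot a')$ to $(\mathbb F_{q^2}^N,(\cdot,\cdot)_t)$. A generator matrix of an additive code is a matrix whose rows form an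 $\mathbb F_p$-basis of it, and a matrix generates the additive group spanned by its rows. Let $\mathcal C,\mathcal C'\subseteq\mathbb F_{q^2}^n$ and $\mathcal E\subseteq\mathbb F_{q^2}^m$ be additive codes with $|\mathcal C|=q^l$, $|\mathcal C'|=|\mathcal E|=q^{2k}$, such that $\mathcal D=\mathcal C+\mathcal C'$ has size $q^{l+2k}$ and minimum distance $d_1$, and $\mathcal E$ has minimum distance $d_2$ (so that $\mathcal E\ne\{0\}$). Let $G,G',E$ be generator matrices of $\mathcal C,\mathcal C',\mathcal E$. Suppose that $$\mathcal C\subseteq\mathcal D\subseteq\mathcal C^{\perp_t}$$ and that $(G'\mid E)$ generates an ACD code. Let $\mathcal M\subseteq\mathbb F_{q^2}^{n+m}$ be the additive code generated by $$\begin{pmatrix}G&0\\G'&E\end{pmatrix}.$$ Then there is an EAQECC-Ne $[[n+m,k,d;c]]_q$ with EA-stabilizer $\phi^{-1}(\mathcal M^{\perp_t})$, where $$c=n+m-l-k\qquad\text{and}\qquad d\ge d_1+d_2 .$$ Here an EAQECC $[[N,k,d;c]]_q$ with EA-stabilizer $S\subseteq\mathbb F_q^{2N}$ is a subspace $Q$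 of $(\mathbb C^q)^{\otimes N}\otimes(\mathbb C^q)^{\otimes c}$ (Alice's and Bob's qudits) such that: $Q$ is the set of all $(V\otimes I)(\psi\otimes\Phi)$ with $\psi\in(\mathbb C^q)^{\otimes k}$, where $\Phi$ is the state of $c$ maximally entangled pairs and $V:(\mathbb C^q)^{\otimes k}\otimes(\mathbb C^q)^{\otimes c}\to(\mathbb C^q)^{\otimes N}$ is an isometry acting on the information and on Alice's halves of the pairs; $Q$ is the joint $1$-eigenspace of an abelian group of generalized Pauli operators $\lambda X(a)Z(b)$ ($|\lambda|=1$) on the $N+c$ qudits that contains no scalar other than $I$ and whose restriction to Alice's qudits is, up to phases, $S$; and $d$ is the least weight of a generalized Pauli error on Alice's qudits that $Q$ does not detect (Knill--Laflamme). An EAQECC-Ne $[[N,k,d;c]]_q$ is such a code together with a stabilizer code $[[N',k']]_q$ with $k'\ge c$ that protects Bob's halves of the $c$ pairs. -/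

import Mathlib

open scoped Matrix

/-! ### Additive codes over the quadratic extension `K` of `F`, where `F` has `q` elements -/

section AdditiveCodes

variable {K : Type*} [Field K]

/-- The Hermitian inner product `∑ i, u i * (v i) ^ q`. -/
def hermInner {A : Type*} [Fintype A] (q : ℕ) (u v : A → K) : K :=
  ∑ i, u i * v i ^ q

/-- The trace inner product `tr (γ * (u, v)_h)` with `γ = (β² - β^(2q))⁻¹`, where `tr` is the
absolute trace from `K` to its prime field. It is alternating, and `codeMap` below is an isometry
from the symplectic space (with the form `tr (a ⬝ b' - b ⬝ a')`) to `A → K` with this form.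
If `q` is even and `β + β ^ q = 1` then `γ = 1`. -/
noncomputable def traceInner (p : ℕ) [Algebra (ZMod p) K] {A : Type*} [Fintype A]
    (q : ℕ) (β : K) (u v : A → K) : ZMod p :=
  Algebra.trace (ZMod p) K ((β ^ 2 - β ^ (2 * q))⁻¹ * hermInner q u v)

/-- The trace dual of an additive code. -/
noncomputable def traceDual (p : ℕ) [Algebra (ZMod p) K] {A : Type*} [Fintype A]
    (q : ℕ) (β : K) (C : AddSubgroup (A → K)) : AddSubgroup (A → K) where
  carrier := {u | ∀ v ∈ C, traceInner p q β u v = 0}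
  zero_mem' := by
    intro v _
    simp [traceInner, hermInner]
  add_mem' := by
    intro u w hu hw v hv
    have h1 := hu v hv
    have h2 := hw v hv
    simp only [traceInner, hermInner] at h1 h2 ⊢
    simp only [Pi.add_apply, add_mul, Finset.sum_add_distrib, mul_add, map_add, h1, h2, add_zero]
  neg_mem' := by
    intro u hu v hv
    have h1 := hu v hv
    simp only [traceInner, hermInner] at h1 ⊢
    simp only [Pi.neg_apply, neg_mul, Finset.sum_neg_distrib, mul_neg, map_neg, h1, neg_zero]

/-- Additive complementary dual codes: the trace radical `C ∩ C^⊥` is zero. -/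
def IsACD (p : ℕ) [Algebra (ZMod p) K] {A : Type*} [Fintype A]
    (q : ℕ) (β : K) (C : AddSubgroup (A → K)) : Prop :=
  C ⊓ traceDual p q β C = ⊥

/-- The additive code generated by the rows of a matrix. -/
def rowCode {R A : Type*} (G : Matrix R A K) : AddSubgroup (A → K) :=
  AddSubgroup.closure (Set.range fun r => G r)

/-- `G` is a generator matrix of the additive code `C`: its rows generate `C` as an additive
group and are independent over the prime field. -/
def IsGeneratorMatrix (p : ℕ) [Algebra (ZMod p) K] {R A : Type*} (G : Matrix R A K)
    (C : AddSubgroup (A → K)) : Prop :=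
  LinearIndependent (ZMod p) (fun r => G r) ∧ rowCode G = C

/-- The minimum (Hamming) distance of the additive code `C` is `d`. In particular `C` is
nonzero. -/
def HasMinDist [DecidableEq K] {A : Type*} [Fintype A] (C : AddSubgroup (A → K)) (d : ℕ) : Prop :=
  IsLeast {w : ℕ | ∃ x ∈ C, x ≠ 0 ∧ hammingNorm x = w} d

/-- The map `(a|b) ↦ β a + β^q b` from the symplectic space to `A → K`. -/
def codeMap {F : Type*} [Field F] [Algebra F K] (A : Type*) (q : ℕ) (β : K) :
    ((A → F) × (A → F)) →+ (A → K) where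
  toFun x := fun i => β * algebraMap F K (x.1 i) + β ^ q * algebraMap F K (x.2 i)
  map_zero' := by
    funext i
    simp
  map_add' := by
    intro x y
    funext i
    simp only [Prod.fst_add, Prod.snd_add, Pi.add_apply, map_add]
    ring

end AdditiveCodes

/-! ### Qudits

The state space of the qudits at the positions in `A` is `(A → F) → ℂ`: the standard basis
vectors `|x⟩` are labelled by `x : A → F`. -/

section Qudits

variable {F : Type*} [Field F] [Fintype F] [DecidableEq F]

/-- The generalized Pauli operator `X(a) Z(b) : |x⟩ ↦ ω ^ tr (b ⬝ x) |x + a⟩`, with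
`ω = exp (2πi/p)` and `tr` the trace from `F` to its prime field. -/
noncomputable def pauli (p : ℕ) [Fact p.Prime] [Algebra (ZMod p) F]
    {A : Type*} [Fintype A] [DecidableEq A] (a b : A → F) : Matrix (A → F) (A → F) ℂ :=
  Matrix.of fun y x =>
    if y = x + a then ZMod.stdAddChar (Algebra.trace (ZMod p) F (b ⬝ᵥ x)) else 0

/-- The operator `g` is `X(a) Z(b)` up to a phase. -/
def HasLabel (p : ℕ) [Fact p.Prime] [Algebra (ZMod p) F]
    {A : Type*} [Fintype A] [DecidableEq A] (g : Matrix (A → F) (A → F) ℂ) (a b : A → F) : Prop :=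
  ∃ z : ℂ, ‖z‖ = 1 ∧ g = z • pauli p a b

/-- An abelian group of (phased) generalized Pauli operators that contains no scalar operator
except the identity. This forces every phase to be a `p`-th root of unity if `p` is odd, and a
fourth root of unity if `p = 2`. -/
def IsStabilizerGroup (p : ℕ) [Fact p.Prime] [Algebra (ZMod p) F]
    {A : Type*} [Fintype A] [DecidableEq A] (T : Subgroup (Matrix (A → F) (A → F) ℂ)ˣ) : Prop :=
  (∀ g ∈ T, ∃ a b : A → F, HasLabel p (g : Matrix (A → F) (A → F) ℂ) a b) ∧
  (∀ g ∈ T, ∀ h ∈ T, g * h = h * g) ∧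
  (∀ g ∈ T, ∀ z : ℂ, (g : Matrix (A → F) (A → F) ℂ) = z • 1 → z = 1)

/-- `Q` is the joint eigenspace of `T` for the eigenvalue 1. -/
def IsStabilizedSpace {A : Type*} [Fintype A] [DecidableEq A]
    (T : Subgroup (Matrix (A → F) (A → F) ℂ)ˣ) (Q : Submodule ℂ ((A → F) → ℂ)) : Prop :=
  ∀ f, f ∈ Q ↔ ∀ g ∈ T, (g : Matrix (A → F) (A → F) ℂ) *ᵥ f = f

/-- `Q` is a stabilizer code `[[N, k]]_q`. -/
def IsStabilizerCode (p : ℕ) [Fact p.Prime] [Algebra (ZMod p) F] (N k : ℕ)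
    (Q : Submodule ℂ ((Fin N → F) → ℂ)) : Prop :=
  (∃ T, IsStabilizerGroup p T ∧ IsStabilizedSpace T Q) ∧
  Module.finrank ℂ Q = Fintype.card F ^ k

/-- The weight of `X(a) Z(b)`: the number of positions at which it is not a scalar. -/
def pauliWeight {A : Type*} [Fintype A] (a b : A → F) : ℕ :=
  (Finset.univ.filter fun i => a i ≠ 0 ∨ b i ≠ 0).card

/-- Alice holds the qudits at the positions in `A`, Bob holds the `c` qudits at the positions in
`Fin c`. The matrix of the encoder `ψ ↦ (V ⊗ 1_B) (ψ ⊗ Φ)`, where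
`Φ = q^(-c/2) ∑ b, |b⟩|b⟩` is the state of `c` maximally entangled pairs and Alice applies `V`
to the `k` qudits of information and her halves of the pairs. -/
noncomputable def encoder {A : Type*} {k c : ℕ}
    (V : Matrix (A → F) ((Fin k → F) × (Fin c → F)) ℂ) :
    Matrix (A ⊕ Fin c → F) (Fin k → F) ℂ :=
  Matrix.of fun x j =>
    ((Real.sqrt ((Fintype.card F : ℝ) ^ c))⁻¹ : ℂ) * V (x ∘ Sum.inl) (j, x ∘ Sum.inr)

/-- `Q` is the code space of an entanglement-assisted code that encodes `k` qudits with the help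
of `c` maximally entangled pairs: `Q` is the image of an encoder as above with `V` an isometry. -/
def IsEACodeSpace {A : Type*} [Fintype A] [DecidableEq A] (k c : ℕ)
    (Q : Submodule ℂ ((A ⊕ Fin c → F) → ℂ)) : Prop :=
  ∃ V : Matrix (A → F) ((Fin k → F) × (Fin c → F)) ℂ,
    Vᴴ * V = 1 ∧ Q = LinearMap.range (Matrix.mulVecLin (encoder V))

/-- `S` (a group of Pauli operators on Alice's qudits, given modulo phases by its labels) is the
EA-stabilizer of `Q`: it extends to an abelian group `T` of Pauli operators on the qudits of Alice
and Bob that stabilizes `Q`. -/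
def IsEAStabilizer (p : ℕ) [Fact p.Prime] [Algebra (ZMod p) F]
    {A : Type*} [Fintype A] [DecidableEq A] {c : ℕ} (S : AddSubgroup ((A → F) × (A → F)))
    (Q : Submodule ℂ ((A ⊕ Fin c → F) → ℂ)) : Prop :=
  ∃ T : Subgroup (Matrix (A ⊕ Fin c → F) (A ⊕ Fin c → F) ℂ)ˣ,
    IsStabilizerGroup p T ∧ IsStabilizedSpace T Q ∧
    ∀ s : (A → F) × (A → F), s ∈ S ↔
      ∃ g ∈ T, ∃ a b : A ⊕ Fin c → F,
        HasLabel p (g : Matrix (A ⊕ Fin c → F) (A ⊕ Fin c → F) ℂ) a b ∧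
        s = (a ∘ Sum.inl, b ∘ Sum.inl)

/-- `Q` detects the error `X(a) Z(b) ⊗ 1_B` on Alice's qudits (Knill-Laflamme condition). -/
def Detects (p : ℕ) [Fact p.Prime] [Algebra (ZMod p) F]
    {A : Type*} [Fintype A] [DecidableEq A] {c : ℕ}
    (Q : Submodule ℂ ((A ⊕ Fin c → F) → ℂ)) (a b : A → F) : Prop :=
  ∃ z : ℂ, ∀ f ∈ Q, ∀ g ∈ Q,
    star f ⬝ᵥ (pauli p (Sum.elim a (0 : Fin c → F)) (Sum.elim b (0 : Fin c → F)) *ᵥ g) =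
      z * (star f ⬝ᵥ g)

/-- `Q` has minimum distance `d`: the least weight of an error on Alice's qudits that `Q` does not
detect is `d`. -/
def HasEADist (p : ℕ) [Fact p.Prime] [Algebra (ZMod p) F]
    {A : Type*} [Fintype A] [DecidableEq A] {c : ℕ}
    (Q : Submodule ℂ ((A ⊕ Fin c → F) → ℂ)) (d : ℕ) : Prop :=
  IsLeast {w : ℕ | ∃ a b : A → F, ¬ Detects p Q a b ∧ pauliWeight a b = w} d

/-- `Q` is an entanglement-assisted code `[[N, k, d; c]]_q` with EA-stabilizer `S`. -/
structure IsEAQECC (p : ℕ) [Fact p.Prime] [Algebra (ZMod p) F]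
    {A : Type*} [Fintype A] [DecidableEq A] (N k d c : ℕ) (S : AddSubgroup ((A → F) × (A → F)))
    (Q : Submodule ℂ ((A ⊕ Fin c → F) → ℂ)) : Prop where
  length : Fintype.card A = N
  codeSpace : IsEACodeSpace k c Q
  eaStabilizer : IsEAStabilizer p S Q
  dist : HasEADist p Q d

/-- There is an entanglement-assisted code with noisy ebits (EAQECC-Ne) `[[N, k, d; c]]_q` with
EA-stabilizer `S`: a pair of an entanglement-assisted code `[[N, k, d; c]]_q` with EA-stabilizer
`S` for Alice, and a stabilizer code `[[N', k']]_q` with `c ≤ k'`, which protects Bob's halves of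
the `c` entangled pairs. -/
def ExistsEAQECCNe (p : ℕ) [Fact p.Prime] [Algebra (ZMod p) F]
    {A : Type*} [Fintype A] [DecidableEq A] (N k d c : ℕ)
    (S : AddSubgroup ((A → F) × (A → F))) : Prop :=
  ∃ Q : Submodule ℂ ((A ⊕ Fin c → F) → ℂ), IsEAQECC p N k d c S Q ∧
    ∃ (N' k' : ℕ) (Q' : Submodule ℂ ((Fin N' → F) → ℂ)),
      IsStabilizerCode p N' k' Q' ∧ c ≤ k'

end Qudits

/-!
The map `codeMap` turns the trace form on codes into the symplectic form `tr (a ⬝ b' - b ⬝ a')` on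
labels of Pauli operators (`traceInner_codeMap`), for which two Pauli operators commute exactly if
their labels are orthogonal. This reduces the theorem to a statement about an additive code `M` of
labels, its orthogonal complement `S` and the radical `M ⊓ S`.

The form on `S` has radical `M ⊓ S`, and by the classification of alternating forms
(`exists_surjective_antiisometry`) there is a surjection `τ` from `S` onto the labels of `c` qudits
that changes the sign of the form, where `2c` is the dimension of `S / (M ⊓ S)` measured in units of
the degree of `F` over its prime field. The graph of `τ` is isotropic. After a choice of phases
(`exists_isPhase`), its Pauli operators form a stabilizer group `T`; the projection onto the
stabilized space `Q` is the average of `T`, and its trace is the dimension of `Q`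
(`exists_stabilizer`). Since `τ` is surjective, each nonidentity Pauli operator of Bob fails to
commute with some element of `T`; hence its matrix coefficients between vectors of `Q` vanish,
Bob's reduced state is maximally mixed, and `Q` is the image of an isometric encoder
(`isEACodeSpace_of_forall_dotProduct_eq_zero`). An error of Alice is undetected exactly if it
commutes with `T` without being in `T` up to a phase, that is, if its label is in `M` but not in
the radical (`exists_entanglementAssisted`).

For the combined code, the ACD condition shows that the radical consists of the words `(x | 0)` with
`x` in `C` (`mem_traceDual_fromBlocks_iff`). A word of `M` outside the radical is therefore
`(x + y | e)` with nonzero `y` in `C'` and the corresponding nonzero `e` in `E`. As the sum of `C` and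
`C'` is direct, the left part is a nonzero word of their sum, and the weight is at least `d₁ + d₂`.
Such words exist because `E` is nonzero, so the minimum distance is attained. Bob's qudits can be
protected by the trivial stabilizer code, which is the whole space.
-/

/-! ### Alternating forms -/

section AlternatingForms

variable {k V W : Type*} [Field k] [AddCommGroup V] [Module k V] [AddCommGroup W] [Module k W]

/-- A family of `g` mutually orthogonal hyperbolic pairs `(e i, f i)` for the form `B`. -/
structure IsHyperbolicFamily (B : LinearMap.BilinForm k V) {g : ℕ} (e f : Fin g → V) : Prop where
  left : ∀ i j, B (e i) (e j) = 0
  right : ∀ i j, B (f i) (f j) = 0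
  pair : ∀ i j, B (e i) (f j) = if i = j then 1 else 0

/-- The coordinates of a vector with respect to a hyperbolic family. -/
def hyperbolicCoord (B : LinearMap.BilinForm k V) {g : ℕ} (e f : Fin g → V) :
    V →ₗ[k] (Fin g → k) × (Fin g → k) :=
  (LinearMap.pi fun i => B.flip (f i)).prod (LinearMap.pi fun i => B (e i))

@[simp]
theorem hyperbolicCoord_fst (B : LinearMap.BilinForm k V) {g : ℕ} (e f : Fin g → V) (x : V)
    (i : Fin g) : (hyperbolicCoord B e f x).1 i = B x (f i) := rfl

@[simp]
theorem hyperbolicCoord_snd (B : LinearMap.BilinForm k V) {g : ℕ} (e f : Fin g → V) (x : V)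
    (i : Fin g) : (hyperbolicCoord B e f x).2 i = B (e i) x := rfl

namespace IsHyperbolicFamily

variable {B : LinearMap.BilinForm k V} {g : ℕ} {e f : Fin g → V}

theorem apply_sum (hB : B.IsAlt) (x : V) (z : (Fin g → k) × (Fin g → k)) :
    B x (∑ i, (z.1 i • e i + z.2 i • f i)) =
      (hyperbolicCoord B e f x).1 ⬝ᵥ z.2 - (hyperbolicCoord B e f x).2 ⬝ᵥ z.1 := by
  simp only [map_sum, map_add, map_smul, smul_eq_mul, dotProduct, hyperbolicCoord_fst,
    hyperbolicCoord_snd, ← Finset.sum_sub_distrib]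
  refine Finset.sum_congr rfl fun i _ => ?_
  rw [← hB.neg_eq (e i) x]
  ring

theorem coord_sum (hB : B.IsAlt) (h : IsHyperbolicFamily B e f)
    (z : (Fin g → k) × (Fin g → k)) :
    hyperbolicCoord B e f (∑ i, (z.1 i • e i + z.2 i • f i)) = z := by
  refine Prod.ext ?_ ?_ <;> funext j
  · rw [hyperbolicCoord_fst, ← hB.neg_eq]
    simp only [map_sum, map_add, map_smul, smul_eq_mul, h.right, ← hB.neg_eq (e _) (f j), h.pair]
    simp
  · rw [hyperbolicCoord_snd]
    simp [h.pair, h.left]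

theorem coord_surjective (hB : B.IsAlt) (h : IsHyperbolicFamily B e f) :
    Function.Surjective (hyperbolicCoord B e f) :=
  fun z => ⟨_, h.coord_sum hB z⟩

/-- Orthogonal hyperbolic pairs are independent, which bounds their number. -/
theorem card_le [FiniteDimensional k V] (hB : B.IsAlt) (h : IsHyperbolicFamily B e f) :
    g ≤ Module.finrank k V := by
  have h1 := LinearMap.finrank_le_finrank_of_surjective (h.coord_surjective hB)
  simp only [Module.finrank_prod, Module.finrank_fin_fun] at h1
  omega

/-- A hyperbolic pair in the orthogonal complement of a hyperbolic family extends it. -/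
theorem cons (hB : B.IsAlt) (h : IsHyperbolicFamily B e f) {x y : V} (hxy : B x y = 1)
    (hx : hyperbolicCoord B e f x = 0) (hy : hyperbolicCoord B e f y = 0) :
    IsHyperbolicFamily B (Fin.cons x e : Fin (g + 1) → V) (Fin.cons y f : Fin (g + 1) → V) := by
  have hx1 : ∀ i, B x (f i) = 0 := fun i => congr_fun (congr_arg Prod.fst hx) i
  have hx2 : ∀ i, B (e i) x = 0 := fun i => congr_fun (congr_arg Prod.snd hx) i
  have hy1 : ∀ i, B y (f i) = 0 := fun i => congr_fun (congr_arg Prod.fst hy) i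
  have hy2 : ∀ i, B (e i) y = 0 := fun i => congr_fun (congr_arg Prod.snd hy) i
  refine ⟨fun i j => ?_, fun i j => ?_, fun i j => ?_⟩ <;>
    refine Fin.cases ?_ (fun i => ?_) i <;> refine Fin.cases ?_ (fun j => ?_) j
  · simpa using hB x
  · simpa using hB.eq_iff.1 (hx2 j)
  · simpa using hx2 i
  · simpa using h.left i j
  · simpa using hB y
  · simpa using hy1 j
  · simpa using hB.eq_iff.1 (hy1 i)
  · simpa using h.right i j
  · simpa using hxy
  · simpa [(Fin.succ_ne_zero j).symm] using hx1 j
  · simpa using hy2 i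
  · simpa using h.pair i j

end IsHyperbolicFamily

/-- Every alternating form is the pullback of a standard symplectic form along a surjective
linear map. The coordinates with respect to a maximal hyperbolic family give such a map. -/
theorem exists_surjective_isometry_standard [FiniteDimensional k V] (B : LinearMap.BilinForm k V)
    (hB : B.IsAlt) :
    ∃ (g : ℕ) (π : V →ₗ[k] (Fin g → k) × (Fin g → k)), Function.Surjective π ∧
      ∀ x y, B x y = (π x).1 ⬝ᵥ (π y).2 - (π x).2 ⬝ᵥ (π y).1 := by
  classical
  let P : ℕ → Prop := fun g => ∃ e f : Fin g → V, IsHyperbolicFamily B e f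
  have hP0 : P 0 := ⟨Fin.elim0, Fin.elim0, ⟨fun i => i.elim0, fun i => i.elim0, fun i => i.elim0⟩⟩
  obtain ⟨e, f, h⟩ : P (Nat.findGreatest P (Module.finrank k V)) :=
    Nat.findGreatest_spec (Nat.zero_le _) hP0
  -- a maximal family leaves no hyperbolic pair in its orthogonal complement
  have hiso : ∀ x y, hyperbolicCoord B e f x = 0 → hyperbolicCoord B e f y = 0 → B x y = 0 := by
    intro x y hx hy
    by_contra hxy
    have h' := h.cons hB (x := x) (y := (B x y)⁻¹ • y) (by simp [hxy]) hx (by simp [hy])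
    have h1 := Nat.le_findGreatest (h'.card_le hB) (show P _ from ⟨_, _, h'⟩)
    omega
  refine ⟨_, hyperbolicCoord B e f, h.coord_surjective hB, fun x y => ?_⟩
  set π := hyperbolicCoord B e f with hπ
  let σ : (Fin _ → k) × (Fin _ → k) → V := fun z => ∑ i, (z.1 i • e i + z.2 i • f i)
  have hσ : ∀ z, π (σ z) = z := h.coord_sum hB
  have hBσ : ∀ x z, B x (σ z) = (π x).1 ⬝ᵥ z.2 - (π x).2 ⬝ᵥ z.1 := IsHyperbolicFamily.apply_sum hB
  have h1 : B (x - σ (π x)) (y - σ (π y)) = 0 :=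
    hiso _ _ (by rw [map_sub, hσ, sub_self]) (by rw [map_sub, hσ, sub_self])
  have h2 : B (x - σ (π x)) (σ (π y)) = 0 := by
    rw [hBσ, map_sub, hσ, sub_self]; simp
  have h3 : B (σ (π x)) (y - σ (π y)) = 0 := by
    rw [← hB.neg_eq, hBσ, map_sub, hσ, sub_self]; simp
  have h4 : B (σ (π x)) (σ (π y)) = (π x).1 ⬝ᵥ (π y).2 - (π x).2 ⬝ᵥ (π y).1 := by
    rw [hBσ, hσ]
  rw [← h4]
  rw [map_sub, h2, sub_zero, map_sub, LinearMap.sub_apply, sub_eq_zero] at h1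
  rw [map_sub, sub_eq_zero] at h3
  rw [h1, h3]

theorem ker_eq_of_isometry_standard {B : LinearMap.BilinForm k V} {g : ℕ}
    {π : V →ₗ[k] (Fin g → k) × (Fin g → k)} (hπ : Function.Surjective π)
    (h : ∀ x y, B x y = (π x).1 ⬝ᵥ (π y).2 - (π x).2 ⬝ᵥ (π y).1) :
    LinearMap.ker π = LinearMap.ker B := by
  ext x
  simp only [LinearMap.mem_ker]
  refine ⟨fun hx => LinearMap.ext fun y => by simp [h, hx], fun hx => ?_⟩
  refine Prod.ext ?_ ?_ <;> funext i
  · obtain ⟨y, hy⟩ := hπ (0, Pi.single i 1)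
    simpa [hx, hy] using (h x y).symm
  · obtain ⟨y, hy⟩ := hπ (Pi.single i 1, 0)
    simpa [hx, hy] using (h x y).symm

/-- An alternating form of rank `dim W` is, up to sign, the pullback of any nondegenerate
alternating form on `W`. -/
theorem exists_surjective_antiisometry [FiniteDimensional k V] [FiniteDimensional k W]
    (B : LinearMap.BilinForm k V) (hB : B.IsAlt) (B' : LinearMap.BilinForm k W) (hB' : B'.IsAlt)
    (hker : LinearMap.ker B' = ⊥)
    (hdim : Module.finrank k W + Module.finrank k (LinearMap.ker B) = Module.finrank k V) :
    ∃ τ : V →ₗ[k] W, Function.Surjective τ ∧ ∀ x y, B' (τ x) (τ y) = - B x y := by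
  obtain ⟨g, π, hπ, h⟩ := exists_surjective_isometry_standard B hB
  obtain ⟨g', π', hπ', h'⟩ := exists_surjective_isometry_standard B' hB'
  have hk := ker_eq_of_isometry_standard hπ h
  have hk' := ker_eq_of_isometry_standard hπ' h'
  have h1 := LinearMap.finrank_range_add_finrank_ker π
  have h2 := LinearMap.finrank_range_add_finrank_ker π'
  rw [hk, LinearMap.range_eq_top.2 hπ, finrank_top] at h1
  rw [hk', hker, LinearMap.range_eq_top.2 hπ', finrank_top, finrank_bot] at h2
  simp only [Module.finrank_prod, Module.finrank_fin_fun] at h1 h2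
  obtain rfl : g = g' := by omega
  let ε := LinearEquiv.ofBijective π' ⟨LinearMap.ker_eq_bot.1 (hk'.trans hker), hπ'⟩
  -- exchanging the two halves of the coordinates changes the sign of the standard form
  refine ⟨ε.symm.toLinearMap ∘ₗ (LinearEquiv.prodComm k _ _).toLinearMap ∘ₗ π,
    ε.symm.surjective.comp ((LinearEquiv.prodComm k _ _).surjective.comp hπ), fun x y => ?_⟩
  have hε : ∀ z, π' (ε.symm z) = z := ε.apply_symm_apply
  rw [h', h]
  simp only [LinearMap.comp_apply, LinearEquiv.coe_coe, hε, LinearEquiv.prodComm_apply,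
    Prod.fst_swap, Prod.snd_swap]
  ring

end AlternatingForms

/-! ### Quadratic phases of symmetric forms over the prime field -/

section Phases

variable {p : ℕ} [Fact p.Prime]

/-- `φ` is a phase function whose failure to be additive is the character of the form `B`. -/
def IsPhase {V : Type*} [Add V] (B : V → V → ZMod p) (φ : V → ℂ) : Prop :=
  (∀ v, ‖φ v‖ = 1) ∧ ∀ v w, φ (v + w) = φ v * φ w * ZMod.stdAddChar (B v w)

theorem norm_stdAddChar (x : ZMod p) : ‖ZMod.stdAddChar x‖ = 1 :=
  AddChar.norm_apply _ _

theorem IsPhase.add {V : Type*} [Add V] {B B' : V → V → ZMod p} {φ φ' : V → ℂ}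
    (h : IsPhase B φ) (h' : IsPhase B' φ') :
    IsPhase (fun v w => B v w + B' v w) (fun v => φ v * φ' v) := by
  refine ⟨fun v => by rw [norm_mul, h.1, h'.1, one_mul], fun v w => ?_⟩
  simp only [h.2, h'.2, AddChar.map_add_eq_mul]
  ring

theorem IsPhase.congr {V : Type*} [Add V] {B B' : V → V → ZMod p} {φ : V → ℂ}
    (h : IsPhase B φ) (hB : ∀ v w, B' v w = B v w) : IsPhase B' φ :=
  ⟨h.1, fun v w => by rw [h.2, hB]⟩

theorem IsPhase.comp {V W : Type*} [AddCommGroup V] [AddCommGroup W] {B : V → V → ZMod p}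
    {φ : V → ℂ} (h : IsPhase B φ) (f : W →+ V) :
    IsPhase (fun v w => B (f v) (f w)) (fun v => φ (f v)) :=
  ⟨fun v => h.1 _, fun v w => by simp only [map_add, h.2]⟩

/-- In dimension one the phase is `ω ^ (c x² / 2)` for odd `p` and a power of `i` for `p = 2`. -/
theorem exists_isPhase_mul (c : ZMod p) : ∃ φ, IsPhase (fun x y : ZMod p => c * x * y) φ := by
  have h3 : (1 + 1 : ZMod 2) = 0 := by decide
  have h4 : (1 : ZMod 2).val = 1 := by decide
  have hc : ∀ z : ZMod 2, z = 0 ∨ z = 1 := by decide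
  rcases (Fact.out : p.Prime).eq_two_or_odd' with rfl | hp
  · refine ⟨fun x => Complex.I ^ (c.val * x.val), fun x => by simp, fun x y => ?_⟩
    have h1 : (ZMod.stdAddChar (1 : ZMod 2) : ℂ) = -1 := by
      have := ZMod.stdAddChar_coe (N := 2) 1
      simp only [Int.cast_one, Nat.cast_ofNat, mul_one] at this
      rw [this, show 2 * (Real.pi : ℂ) * Complex.I / 2 = Real.pi * Complex.I by ring,
        Complex.exp_pi_mul_I]
    rcases hc c with rfl | rfl <;> rcases hc x with rfl | rfl <;> rcases hc y with rfl | rfl <;>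
      simp [h1, h3, h4]
  · have h2 : (2 : ZMod p) ≠ 0 := by
      have h : ((2 : ℕ) : ZMod p) ≠ 0 := by
        rw [Ne, ZMod.natCast_eq_zero_iff]
        intro h
        have := (Nat.prime_dvd_prime_iff_eq Fact.out Nat.prime_two).1 h
        subst this
        exact absurd hp (by decide)
      simpa using h
    refine ⟨fun x => ZMod.stdAddChar (c * x * x / 2), fun x => norm_stdAddChar _, fun x y => ?_⟩
    simp only [← AddChar.map_add_eq_mul]
    congr 1
    field_simp
    ring

theorem exists_isPhase_matrix : ∀ (n : ℕ) (M : Matrix (Fin n) (Fin n) (ZMod p)), M.IsSymm →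
    ∃ φ, IsPhase (fun v w : Fin n → ZMod p => ∑ i, ∑ j, v i * M i j * w j) φ
  | 0, _, _ => ⟨fun _ => 1, by simp, by simp⟩
  | n + 1, M, hM => by
    obtain ⟨φ, hφ⟩ := exists_isPhase_mul (M 0 0)
    obtain ⟨ψ, hψ⟩ := exists_isPhase_matrix n (M.submatrix Fin.succ Fin.succ) (hM.submatrix _)
    let l : (Fin (n + 1) → ZMod p) → ZMod p := fun v => ∑ j : Fin n, M 0 j.succ * v j.succ
    have hl : ∀ v w, l (v + w) = l v + l w := fun v w => by
      simp only [l, Pi.add_apply, mul_add, Finset.sum_add_distrib]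
    -- the mixed terms `v 0 * l w + l v * w 0` are the polarization of `v 0 * l v`
    have hmix : IsPhase (fun v w : Fin (n + 1) → ZMod p => v 0 * l w + l v * w 0)
        (fun v => ZMod.stdAddChar (v 0 * l v)) := by
      refine ⟨fun v => norm_stdAddChar _, fun v w => ?_⟩
      simp only [hl, Pi.add_apply, ← AddChar.map_add_eq_mul]
      congr 1
      ring
    have h := ((hφ.comp (Pi.evalAddMonoidHom (fun _ : Fin (n + 1) => ZMod p) 0)).add hmix).add
      (hψ.comp (LinearMap.funLeft (ZMod p) (ZMod p) (Fin.succ (n := n))).toAddMonoidHom)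
    refine ⟨_, h.congr fun v w => ?_⟩
    simp only [Fin.sum_univ_succ, l, Pi.evalAddMonoidHom_apply, LinearMap.toAddMonoidHom_coe,
      LinearMap.funLeft_apply, Matrix.submatrix_apply, Finset.sum_add_distrib, Finset.mul_sum,
      Finset.sum_mul]
    have h1 : ∀ j : Fin n, M j.succ 0 = M 0 j.succ := fun j => hM.apply _ _
    simp only [h1, mul_comm, mul_left_comm]
    ring

/-- The multiplicative 2-cocycle of a symmetric form is the coboundary of a phase function. -/
theorem exists_isPhase {V : Type*} [AddCommGroup V] [Module (ZMod p) V]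
    [FiniteDimensional (ZMod p) V] (B : LinearMap.BilinForm (ZMod p) V)
    (hB : ∀ v w, B v w = B w v) : ∃ φ, IsPhase (fun v w => B v w) φ := by
  let b := Module.finBasis (ZMod p) V
  obtain ⟨φ, hφ⟩ := exists_isPhase_matrix _ (Matrix.of fun i j => B (b i) (b j))
    (Matrix.IsSymm.ext fun i j => hB _ _)
  refine ⟨_, (hφ.comp b.equivFun.toLinearMap.toAddMonoidHom).congr fun v w => ?_⟩
  conv_lhs => rw [← b.sum_equivFun v, ← b.sum_equivFun w]
  simp only [map_sum, LinearMap.sum_apply, map_smul, LinearMap.smul_apply, smul_eq_mul,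
    Finset.mul_sum, Matrix.of_apply, LinearMap.toAddMonoidHom_coe, LinearEquiv.coe_coe]
  rw [Finset.sum_comm]
  exact Finset.sum_congr rfl fun i _ => Finset.sum_congr rfl fun j _ => by ring

theorem IsPhase.map_zero {V : Type*} [AddCommGroup V] [Module (ZMod p) V]
    {B : LinearMap.BilinForm (ZMod p) V} {φ : V → ℂ} (h : IsPhase (fun v w => B v w) φ) :
    φ 0 = 1 := by
  have h1 := h.2 0 0
  have h0 : φ 0 ≠ 0 := norm_ne_zero_iff.1 (by rw [h.1]; exact one_ne_zero)
  simpa [h0] using h1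

end Phases

/-! ### Pauli operators -/

section PauliOperators

variable {p : ℕ} [Fact p.Prime] {F : Type*} [Field F] [Algebra (ZMod p) F]
  {A : Type*} [Fintype A]

variable (p F A) in
/-- The form `(a|b), (a'|b') ↦ tr (b ⬝ a')`, which governs the phase in the product of two
Pauli operators. -/
noncomputable def pauliForm : LinearMap.BilinForm (ZMod p) ((A → F) × (A → F)) :=
  LinearMap.mk₂ (ZMod p) (fun v w => Algebra.trace (ZMod p) F (v.2 ⬝ᵥ w.1))
    (fun v v' w => by simp [add_dotProduct]) (fun c v w => by simp [smul_dotProduct])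
    (fun v w w' => by simp [dotProduct_add]) (fun c v w => by simp [dotProduct_smul])

variable (p F A) in
/-- The trace symplectic form `(a|b), (a'|b') ↦ tr (a ⬝ b' - b ⬝ a')`. -/
noncomputable def sympForm : LinearMap.BilinForm (ZMod p) ((A → F) × (A → F)) :=
  (pauliForm p F A).flip - pauliForm p F A

theorem pauliForm_apply (v w : (A → F) × (A → F)) :
    pauliForm p F A v w = Algebra.trace (ZMod p) F (v.2 ⬝ᵥ w.1) := rfl

theorem sympForm_apply (v w : (A → F) × (A → F)) :
    sympForm p F A v w = pauliForm p F A w v - pauliForm p F A v w := rfl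

theorem sympForm_apply' (v w : (A → F) × (A → F)) :
    sympForm p F A v w = Algebra.trace (ZMod p) F (v.1 ⬝ᵥ w.2 - v.2 ⬝ᵥ w.1) := by
  rw [sympForm_apply, pauliForm_apply, pauliForm_apply, map_sub, dotProduct_comm w.2]

theorem sympForm_isAlt : (sympForm p F A).IsAlt := fun v => by rw [sympForm_apply, sub_self]

theorem pauli_zero [DecidableEq F] [DecidableEq A] : pauli p (0 : A → F) (0 : A → F) = 1 := by
  ext y x
  simp [pauli, Matrix.one_apply]

variable [Fintype F]

theorem exists_trace_mul_ne_zero {b : F} (hb : b ≠ 0) :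
    ∃ t, Algebra.trace (ZMod p) F (b * t) ≠ 0 := by
  by_contra! h
  exact hb ((traceForm_nondegenerate (ZMod p) F).1 b h)

theorem exists_trace_dotProduct_ne_zero {b : A → F} (hb : b ≠ 0) :
    ∃ x, Algebra.trace (ZMod p) F (b ⬝ᵥ x) ≠ 0 := by
  classical
  obtain ⟨i, hi⟩ := Function.ne_iff.1 hb
  obtain ⟨t, ht⟩ := exists_trace_mul_ne_zero (p := p) hi
  exact ⟨Pi.single i t, by simpa using ht⟩

theorem exists_sympForm_ne_zero {v : (A → F) × (A → F)} (hv : v ≠ 0) :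
    ∃ w, sympForm p F A v w ≠ 0 := by
  by_cases h : v.1 = 0
  · have h2 : v.2 ≠ 0 := fun h2 => hv (Prod.ext h h2)
    obtain ⟨x, hx⟩ := exists_trace_dotProduct_ne_zero (p := p) h2
    exact ⟨(x, 0), by simpa [sympForm_apply'] using hx⟩
  · obtain ⟨x, hx⟩ := exists_trace_dotProduct_ne_zero (p := p) h
    exact ⟨(0, x), by simpa [sympForm_apply'] using hx⟩

theorem ker_sympForm : LinearMap.ker (sympForm p F A) = ⊥ := by
  refine LinearMap.ker_eq_bot'.2 fun v hv => ?_
  by_contra h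
  obtain ⟨w, hw⟩ := exists_sympForm_ne_zero (p := p) h
  exact hw (by rw [hv]; rfl)

theorem sum_stdAddChar_trace (b : A → F) [DecidableEq A] [DecidableEq F] :
    ∑ x, ZMod.stdAddChar (Algebra.trace (ZMod p) F (b ⬝ᵥ x)) =
      if b = 0 then (Fintype.card F : ℂ) ^ Fintype.card A else 0 := by
  split_ifs with hb
  · simp [hb]
  · obtain ⟨x, hx⟩ := exists_trace_dotProduct_ne_zero (p := p) hb
    let l : (A → F) →+ ZMod p :=
      ⟨⟨fun x => Algebra.trace (ZMod p) F (b ⬝ᵥ x), by simp⟩, by simp [dotProduct_add]⟩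
    refine AddChar.sum_eq_zero_of_ne_one
      (ψ := (ZMod.stdAddChar (N := p)).compAddMonoidHom l) fun h => hx ?_
    refine ZMod.injective_stdAddChar ?_
    have := DFunLike.congr_fun h x
    simpa [l] using this

variable [DecidableEq F] [DecidableEq A]

theorem pauli_mulVec (a b : A → F) (f : (A → F) → ℂ) (y : A → F) :
    (pauli p a b *ᵥ f) y =
      ZMod.stdAddChar (Algebra.trace (ZMod p) F (b ⬝ᵥ (y - a))) * f (y - a) := by
  rw [Matrix.mulVec, dotProduct, Finset.sum_eq_single (y - a)]
  · simp [pauli]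
  · intro x _ hx
    have : y ≠ x + a := fun h => hx (by rw [h, add_sub_cancel_right])
    simp [pauli, this]
  · simp

theorem pauli_mul_pauli (v w : (A → F) × (A → F)) :
    pauli p v.1 v.2 * pauli p w.1 w.2 =
      (ZMod.stdAddChar (pauliForm p F A v w) : ℂ) • pauli p (v + w).1 (v + w).2 := by
  refine Matrix.ext_of_mulVec_single fun x => funext fun y => ?_
  rw [← Matrix.mulVec_mulVec, Matrix.smul_mulVec, Pi.smul_apply, pauli_mulVec, pauli_mulVec,
    pauli_mulVec, pauliForm_apply, smul_eq_mul, ← mul_assoc, ← mul_assoc,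
    ← AddChar.map_add_eq_mul, ← AddChar.map_add_eq_mul, ← map_add, ← map_add, Prod.fst_add,
    Prod.snd_add, sub_sub]
  congr 3
  simp only [add_dotProduct, dotProduct_sub, dotProduct_add]
  ring_nf

theorem trace_pauli (v : (A → F) × (A → F)) :
    (pauli p v.1 v.2).trace = if v = 0 then (Fintype.card F : ℂ) ^ Fintype.card A else 0 := by
  rw [Matrix.trace]
  by_cases h : v.1 = 0
  · have h' : v = 0 ↔ v.2 = 0 := ⟨fun h => by rw [h]; rfl, fun h2 => Prod.ext h h2⟩
    simp only [Matrix.diag_apply, pauli, Matrix.of_apply, h, add_zero, if_true,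
      sum_stdAddChar_trace, h']
  · have h' : v ≠ 0 := fun h' => h (by rw [h']; rfl)
    simp [pauli, h, h']

theorem conjTranspose_pauli_mul_pauli (a b : A → F) : (pauli p a b)ᴴ * pauli p a b = 1 := by
  ext x x'
  rw [Matrix.mul_apply, Finset.sum_eq_single (x' + a)]
  · by_cases h : x = x'
    · subst h
      simp [pauli, ← Complex.normSq_eq_conj_mul_self, Complex.normSq_eq_norm_sq]
    · simp [pauli, h, Ne.symm h]
  · intro y _ hy
    simp [pauli, hy]
  · simp

theorem pauli_comm (v w : (A → F) × (A → F)) :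
    pauli p v.1 v.2 * pauli p w.1 w.2 =
      (ZMod.stdAddChar (sympForm p F A w v) : ℂ) • (pauli p w.1 w.2 * pauli p v.1 v.2) := by
  rw [pauli_mul_pauli, pauli_mul_pauli, smul_smul, ← AddChar.map_add_eq_mul, sympForm_apply,
    sub_add_cancel, add_comm w v]

/-- Pauli operators that are proportional have the same label: otherwise the trace of
`X(a)Z(b)` times the inverse of the other one would vanish. -/
theorem pauli_eq_smul_pauli {v w : (A → F) × (A → F)} {z : ℂ}
    (h : pauli p v.1 v.2 = z • pauli p w.1 w.2) : v = w := by
  have h1 : pauli p v.1 v.2 * pauli p (-w).1 (-w).2 =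
      z • (pauli p w.1 w.2 * pauli p (-w).1 (-w).2) := by rw [h, Matrix.smul_mul]
  have h2 := pauli_mul_pauli (p := p) w (-w)
  have h3 := pauli_mul_pauli (p := p) v (-v)
  have hne : ∀ x : ZMod p, (ZMod.stdAddChar x : ℂ) ≠ 0 := fun x =>
    norm_ne_zero_iff.1 (by rw [norm_stdAddChar]; exact one_ne_zero)
  have hq : (Fintype.card F : ℂ) ^ Fintype.card A ≠ 0 := by simp
  have hz : z ≠ 0 := by
    rintro rfl
    rw [zero_smul] at h
    have := congr_arg Matrix.trace h3
    rw [h, Matrix.zero_mul, Matrix.trace_zero, Matrix.trace_smul, trace_pauli, add_neg_cancel,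
      if_pos rfl, smul_eq_mul] at this
    exact mul_ne_zero (hne _) hq this.symm
  by_contra hvw
  have h4 := congr_arg Matrix.trace h1
  rw [pauli_mul_pauli, pauli_mul_pauli, Matrix.trace_smul, trace_pauli, Matrix.trace_smul,
    Matrix.trace_smul, trace_pauli, add_neg_cancel, if_pos rfl,
    if_neg (by rwa [← sub_eq_add_neg, sub_eq_zero]), smul_zero] at h4
  exact mul_ne_zero hz (mul_ne_zero (hne _) hq) h4.symm

end PauliOperators

/-! ### Stabilizer codes of isotropic subspaces -/

section Stabilizer

variable {p : ℕ} [Fact p.Prime] {F : Type*} [Field F] [Fintype F] [DecidableEq F]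
  [Algebra (ZMod p) F] {A : Type*} [Fintype A] [DecidableEq A]

/-- On an isotropic subspace, phases can be chosen such that the Pauli operators form a
representation. -/
theorem exists_pauli_representation (L : Submodule (ZMod p) ((A → F) × (A → F)))
    (hL : ∀ v ∈ L, ∀ w ∈ L, sympForm p F A v w = 0) :
    ∃ (φ : L → ℂ) (ρ : Multiplicative L →* Matrix (A → F) (A → F) ℂ), (∀ v, ‖φ v‖ = 1) ∧
      φ 0 = 1 ∧ ∀ v : L, ρ (Multiplicative.ofAdd v) = φ v • pauli p v.1.1 v.1.2 := by
  obtain ⟨φ, hφ⟩ := exists_isPhase ((pauliForm p F A).restrict L) fun v w =>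
    (sub_eq_zero.1 (hL v v.2 w w.2)).symm
  refine ⟨φ, ⟨⟨fun v => φ v.toAdd • pauli p v.toAdd.1.1 v.toAdd.1.2, ?_⟩, ?_⟩, hφ.1,
    hφ.map_zero, fun v => rfl⟩
  · rw [toAdd_one, hφ.map_zero, one_smul]
    exact pauli_zero
  · intro v w
    simp only [toAdd_mul, hφ.2, Matrix.smul_mul, Matrix.mul_smul, smul_smul, pauli_mul_pauli]
    rw [mul_left_comm, mul_assoc]
    rfl

/-- The projection onto the space fixed by a representation by Pauli operators is the average of
the operators; since the trace of a nonscalar Pauli operator is zero, this determines the dimension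
of the space, and a Pauli operator that acts on it as a nonzero scalar belongs to the group up to a
phase. -/
theorem exists_stabilizer (L : Submodule (ZMod p) ((A → F) × (A → F)))
    (hL : ∀ v ∈ L, ∀ w ∈ L, sympForm p F A v w = 0) :
    ∃ (T : Subgroup (Matrix (A → F) (A → F) ℂ)ˣ) (Q : Submodule ℂ ((A → F) → ℂ)),
      IsStabilizerGroup p T ∧ IsStabilizedSpace T Q ∧
      (∀ v : (A → F) × (A → F), v ∈ L ↔
        ∃ g ∈ T, HasLabel p (g : Matrix (A → F) (A → F) ℂ) v.1 v.2) ∧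
      Module.finrank ℂ Q * Nat.card L = Fintype.card F ^ Fintype.card A ∧
      ∀ v ∉ L, ∀ z : ℂ, z ≠ 0 → ¬ ∀ f ∈ Q, pauli p v.1 v.2 *ᵥ f = z • f := by
  classical
  obtain ⟨φ, ρ, hφ, hφ0, hρ⟩ := exists_pauli_representation L hL
  have hφne : ∀ v, φ v ≠ 0 := fun v => norm_ne_zero_iff.1 (by rw [hφ]; exact one_ne_zero)
  let U : L → Matrix (A → F) (A → F) ℂ := fun v => ρ (Multiplicative.ofAdd v)
  have hU : ∀ v : L, U v = φ v • pauli p v.1.1 v.1.2 := hρ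
  have hUmul : ∀ v w, U v * U w = U (v + w) := fun v w => (map_mul ρ _ _).symm
  let T : Subgroup (Matrix (A → F) (A → F) ℂ)ˣ := ρ.toHomUnits.range
  have hT : ∀ g, g ∈ T ↔ ∃ v : L, (g : Matrix (A → F) (A → F) ℂ) = U v := by
    intro g
    constructor
    · rintro ⟨v, rfl⟩
      exact ⟨v.toAdd, rfl⟩
    · rintro ⟨v, hv⟩
      exact ⟨Multiplicative.ofAdd v, Units.ext hv.symm⟩
  have hUT : ∀ v, ∃ g ∈ T, (g : Matrix (A → F) (A → F) ℂ) = U v := fun v =>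
    ⟨ρ.toHomUnits (Multiplicative.ofAdd v), ⟨_, rfl⟩, rfl⟩
  let Q : Submodule ℂ ((A → F) → ℂ) :=
    { carrier := {f | ∀ v, U v *ᵥ f = f}
      zero_mem' := fun v => Matrix.mulVec_zero _
      add_mem' := fun {f g} hf hg v => by rw [Matrix.mulVec_add, hf, hg]
      smul_mem' := fun c f hf v => by rw [Matrix.mulVec_smul, hf] }
  have hQ : ∀ f, f ∈ Q ↔ ∀ v, U v *ᵥ f = f := fun f => Iff.rfl
  let N : ℂ := Fintype.card L
  have hN : N ≠ 0 := Nat.cast_ne_zero.2 Fintype.card_ne_zero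
  let Pr : Matrix (A → F) (A → F) ℂ := N⁻¹ • ∑ v, U v
  have hUPr : ∀ v, U v * Pr = Pr := by
    intro v
    simp only [Pr, Matrix.mul_smul, Finset.mul_sum, hUmul]
    congr 1
    exact Fintype.sum_equiv (Equiv.addLeft v) _ _ fun w => rfl
  have hPrQ : ∀ f, Pr *ᵥ f ∈ Q := fun f v => by rw [Matrix.mulVec_mulVec, hUPr]
  have hPrf : ∀ f ∈ Q, Pr *ᵥ f = f := by
    intro f hf
    simp only [Pr, Matrix.smul_mulVec, Matrix.sum_mulVec]
    rw [Finset.sum_congr rfl fun v _ => hf v, Finset.sum_const, Finset.card_univ,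
      ← Nat.cast_smul_eq_nsmul ℂ, smul_smul, inv_mul_cancel₀ hN, one_smul]
  have hproj : LinearMap.IsProj Q Pr.toLin' := ⟨hPrQ, hPrf⟩
  have htrU : ∀ v : L, (U v).trace =
      if v = 0 then (Fintype.card F : ℂ) ^ Fintype.card A else 0 := by
    intro v
    rw [hU, Matrix.trace_smul, trace_pauli]
    by_cases hv : v = 0
    · simp [hv, hφ0]
    · simp [hv]
  have htrPr : N * Pr.trace = (Fintype.card F : ℂ) ^ Fintype.card A := by
    simp only [Pr, Matrix.trace_smul, Matrix.trace_sum, htrU, smul_eq_mul]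
    rw [mul_inv_cancel_left₀ hN]
    simp
  refine ⟨T, Q, ⟨?_, ?_, ?_⟩, ?_, ?_, ?_, ?_⟩
  · intro g hg
    obtain ⟨v, hv⟩ := (hT g).1 hg
    exact ⟨v.1.1, v.1.2, φ v, hφ v, by rw [hv, hU]⟩
  · intro g hg h hh
    obtain ⟨v, hv⟩ := (hT g).1 hg
    obtain ⟨w, hw⟩ := (hT h).1 hh
    refine Units.ext ?_
    rw [Units.val_mul, Units.val_mul, hv, hw, hUmul, hUmul, add_comm]
  · intro g hg z hz
    obtain ⟨v, hv⟩ := (hT g).1 hg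
    rw [hv, hU] at hz
    have h1 : pauli p v.1.1 v.1.2 = ((φ v)⁻¹ * z) • pauli p (0 : (A → F) × (A → F)).1
        (0 : (A → F) × (A → F)).2 := by
      rw [mul_smul, Prod.fst_zero, Prod.snd_zero, pauli_zero, ← hz, smul_smul,
        inv_mul_cancel₀ (hφne v), one_smul]
    have hv0 : v = 0 := Subtype.ext (pauli_eq_smul_pauli h1)
    rw [hv0, hφ0, one_smul] at hz
    have h2 := congr_fun (congr_fun hz 0) 0
    simpa [pauli] using h2.symm
  · intro f
    rw [hQ]
    constructor
    · intro h g hg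
      obtain ⟨v, hv⟩ := (hT g).1 hg
      rw [hv, h]
    · intro h v
      obtain ⟨g, hg, hv⟩ := hUT v
      rw [← hv, h g hg]
  · intro v
    constructor
    · intro hv
      obtain ⟨g, hg, h⟩ := hUT ⟨v, hv⟩
      exact ⟨g, hg, φ ⟨v, hv⟩, hφ _, by rw [h, hU]⟩
    · rintro ⟨g, hg, z, hz, h⟩
      obtain ⟨w, hw⟩ := (hT g).1 hg
      have hz0 : z ≠ 0 := norm_ne_zero_iff.1 (by rw [hz]; exact one_ne_zero)
      rw [hw, hU] at h
      have h1 : pauli p v.1 v.2 = (z⁻¹ * φ w) • pauli p w.1.1 w.1.2 := by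
        rw [mul_smul, h, smul_smul, inv_mul_cancel₀ hz0, one_smul]
      rw [pauli_eq_smul_pauli h1]
      exact w.2
  · have h1 := hproj.trace
    rw [Matrix.trace_toLin'_eq] at h1
    simp only [h1, N] at htrPr
    rw [Nat.card_eq_fintype_card, mul_comm]
    exact_mod_cast htrPr
  · intro v hv z hz h
    -- `X(a)Z(b) Pr` has trace zero, as no product of `X(a)Z(b)` with a group element is scalar
    have h1 : pauli p v.1 v.2 * Pr = z • Pr := by
      refine Matrix.ext_of_mulVec_single fun x => ?_
      rw [← Matrix.mulVec_mulVec]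
      exact (h _ (hPrQ _)).trans (Matrix.smul_mulVec _ _ _).symm
    have h2 : (pauli p v.1 v.2 * Pr).trace = 0 := by
      simp only [Pr, Matrix.mul_smul, Finset.mul_sum, Matrix.trace_smul, Matrix.trace_sum]
      rw [Finset.sum_eq_zero, smul_zero]
      intro w _
      rw [hU, Matrix.mul_smul, pauli_mul_pauli, Matrix.trace_smul, Matrix.trace_smul, trace_pauli,
        if_neg, smul_zero, smul_zero]
      intro h0
      exact hv (by rw [eq_neg_of_add_eq_zero_left h0]; exact L.neg_mem w.2)
    rw [h1, Matrix.trace_smul, smul_eq_mul] at h2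
    have h3 : N * Pr.trace = 0 := by rw [(mul_eq_zero.1 h2).resolve_left hz, mul_zero]
    rw [htrPr] at h3
    simp at h3

/-- A Pauli operator that fails to commute with the stabilizer maps the stabilized space to an
orthogonal one. -/
theorem dotProduct_pauli_eq_zero {T : Subgroup (Matrix (A → F) (A → F) ℂ)ˣ}
    {Q : Submodule ℂ ((A → F) → ℂ)} (hQ : IsStabilizedSpace T Q)
    {g : (Matrix (A → F) (A → F) ℂ)ˣ} (hg : g ∈ T) {v w : (A → F) × (A → F)}
    (hw : HasLabel p (g : Matrix (A → F) (A → F) ℂ) w.1 w.2) (hvw : sympForm p F A w v ≠ 0)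
    {f h : (A → F) → ℂ} (hf : f ∈ Q) (hh : h ∈ Q) :
    star f ⬝ᵥ (pauli p v.1 v.2 *ᵥ h) = 0 := by
  obtain ⟨z, hz, hgz⟩ := hw
  set M : Matrix (A → F) (A → F) ℂ := g.val with hM
  have hunit : Mᴴ * M = 1 := by
    rw [hgz, Matrix.conjTranspose_smul, Matrix.smul_mul, Matrix.mul_smul,
      conjTranspose_pauli_mul_pauli, smul_smul]
    simp [← Complex.normSq_eq_conj_mul_self, Complex.normSq_eq_norm_sq, hz]
  have h1 : pauli p v.1 v.2 * M =
      (ZMod.stdAddChar (sympForm p F A w v) : ℂ) • (M * pauli p v.1 v.2) := by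
    rw [hgz, Matrix.mul_smul, pauli_comm, Matrix.smul_mul, smul_comm]
  have h2 : ∀ y, star f ⬝ᵥ (M *ᵥ y) = star f ⬝ᵥ y := by
    intro y
    conv_lhs => rw [← (hQ f).1 hf g hg]
    rw [Matrix.star_mulVec, ← Matrix.dotProduct_mulVec, Matrix.mulVec_mulVec, ← hM, hunit,
      Matrix.one_mulVec]
  have h3 : star f ⬝ᵥ (pauli p v.1 v.2 *ᵥ h) = ZMod.stdAddChar (sympForm p F A w v) *
      (star f ⬝ᵥ (pauli p v.1 v.2 *ᵥ h)) := by
    conv_lhs => rw [← (hQ h).1 hh g hg]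
    rw [← hM, Matrix.mulVec_mulVec, h1, Matrix.smul_mulVec, dotProduct_smul,
      ← Matrix.mulVec_mulVec, h2, smul_eq_mul]
  by_contra h0
  refine hvw (ZMod.injective_stdAddChar ?_)
  rw [AddChar.map_zero_eq_one]
  exact (mul_right_cancel₀ h0 ((one_mul _).trans h3)).symm

/-- The space stabilized by the trivial group is everything. -/
theorem isStabilizerCode_top (c : ℕ) :
    IsStabilizerCode p c c (⊤ : Submodule ℂ ((Fin c → F) → ℂ)) := by
  refine ⟨⟨⊥, ⟨?_, ?_, ?_⟩, ?_⟩, ?_⟩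
  · intro g hg
    rw [Subgroup.mem_bot.1 hg]
    exact ⟨0, 0, 1, norm_one, by rw [pauli_zero, one_smul, Units.val_one]⟩
  · intro g hg h hh
    rw [Subgroup.mem_bot.1 hg, Subgroup.mem_bot.1 hh]
  · intro g hg z hz
    rw [Subgroup.mem_bot.1 hg, Units.val_one] at hz
    have h2 := congr_fun (congr_fun hz 0) 0
    simpa using h2.symm
  · intro f
    simp only [Submodule.mem_top, true_iff]
    intro g hg
    rw [Subgroup.mem_bot.1 hg, Units.val_one, Matrix.one_mulVec]
  · rw [finrank_top, Module.finrank_fintype_fun_eq_card, Fintype.card_fun, Fintype.card_fin]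

end Stabilizer

/-! ### Entanglement-assisted codes from additive codes -/

section EntanglementAssisted

variable {p : ℕ} [Fact p.Prime] {F : Type*} [Field F] [Algebra (ZMod p) F] {A B : Type*}

variable (p F A B) in
/-- The label of a tensor product of two Pauli operators. -/
def joinLabels : ((A → F) × (A → F)) × ((B → F) × (B → F)) →ₗ[ZMod p]
    (A ⊕ B → F) × (A ⊕ B → F) where
  toFun v := (Sum.elim v.1.1 v.2.1, Sum.elim v.1.2 v.2.2)
  map_add' v w := by ext (i | i) <;> rfl
  map_smul' c v := by ext (i | i) <;> rfl

theorem joinLabels_apply (v : (A → F) × (A → F)) (w : (B → F) × (B → F)) :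
    joinLabels p F A B (v, w) = (Sum.elim v.1 w.1, Sum.elim v.2 w.2) := rfl

theorem joinLabels_left_injective {v v' : (A → F) × (A → F)} {w w' : (B → F) × (B → F)}
    (h : joinLabels p F A B (v, w) = joinLabels p F A B (v', w')) : v = v' := by
  refine Prod.ext ?_ ?_ <;> funext i
  · exact congr_fun (congr_arg Prod.fst h) (Sum.inl i)
  · exact congr_fun (congr_arg Prod.snd h) (Sum.inl i)

variable [Fintype A] [Fintype B]

theorem sympForm_joinLabels (v v' : (A → F) × (A → F)) (w w' : (B → F) × (B → F)) :
    sympForm p F (A ⊕ B) (joinLabels p F A B (v, w)) (joinLabels p F A B (v', w')) =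
      sympForm p F A v v' + sympForm p F B w w' := by
  simp only [sympForm_apply', joinLabels_apply, sumElim_dotProduct_sumElim, ← map_add]
  congr 1
  ring

variable [Fintype F]

/-- Fourier inversion for the characters `y ↦ ω ^ tr (b ⬝ y)`. -/
theorem sum_stdAddChar_mul_sum_stdAddChar [DecidableEq F] [DecidableEq B] (g : (B → F) → ℂ)
    (y₀ : B → F) :
    ∑ b : B → F, ZMod.stdAddChar (-Algebra.trace (ZMod p) F (b ⬝ᵥ y₀)) *
        ∑ y, ZMod.stdAddChar (Algebra.trace (ZMod p) F (b ⬝ᵥ y)) * g y =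
      (Fintype.card F : ℂ) ^ Fintype.card B * g y₀ := by
  simp only [Finset.mul_sum, ← mul_assoc, ← AddChar.map_add_eq_mul]
  rw [Finset.sum_comm]
  have h : ∀ b y : B → F, -Algebra.trace (ZMod p) F (b ⬝ᵥ y₀) + Algebra.trace (ZMod p) F (b ⬝ᵥ y) =
      Algebra.trace (ZMod p) F ((y - y₀) ⬝ᵥ b) := fun b y => by
    rw [dotProduct_comm _ b, dotProduct_sub, map_sub]
    ring
  simp only [h, ← Finset.sum_mul, sum_stdAddChar_trace, sub_eq_zero]
  simp

/-- A subspace of dimension `n` of `ι → ℂ` has an orthonormal basis indexed by any type with `n`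
elements. -/
theorem exists_orthonormal_family {ι J : Type*} [Fintype ι] [Fintype J] [DecidableEq J]
    (Q : Submodule ℂ (ι → ℂ)) (hQ : Module.finrank ℂ Q = Fintype.card J) :
    ∃ f : J → ι → ℂ, (∀ i j, star (f i) ⬝ᵥ f j = if i = j then 1 else 0) ∧
      Submodule.span ℂ (Set.range f) = Q := by
  let e := WithLp.linearEquiv 2 ℂ (ι → ℂ)
  let Q' : Submodule ℂ (EuclideanSpace ℂ ι) := Q.comap e.toLinearMap
  have hQ' : Q'.map e.toLinearMap = Q := Submodule.map_comap_eq_of_surjective e.surjective Q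
  have hdim : Module.finrank ℂ Q' = Fintype.card J := by
    rw [← hQ, ← LinearEquiv.finrank_map_eq e Q']
    exact congr_arg (fun S : Submodule ℂ (ι → ℂ) => Module.finrank ℂ S) hQ'
  let b := (stdOrthonormalBasis ℂ Q').reindex (Fintype.equivOfCardEq (by simpa using hdim))
  refine ⟨(e.toLinearMap ∘ₗ Q'.subtype) ∘ b, fun i j => ?_, ?_⟩
  · rw [← orthonormal_iff_ite.1 b.orthonormal i j, Submodule.coe_inner,
      EuclideanSpace.inner_eq_star_dotProduct, dotProduct_comm]
    rfl
  · rw [Set.range_comp, Submodule.span_image, ← b.coe_toBasis, b.toBasis.span_eq,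
      Submodule.map_top, LinearMap.range_comp, Submodule.range_subtype, hQ']

variable [DecidableEq F] [DecidableEq A]

/-- The code space of an entanglement-assisted code: if no nonidentity Pauli operator on Bob's
qudits commutes with the stabilizer, then Bob's reduced state is maximally mixed for each code word,
so that the code space comes from an isometric encoder. -/
theorem isEACodeSpace_of_forall_dotProduct_eq_zero {k c : ℕ}
    (Q : Submodule ℂ ((A ⊕ Fin c → F) → ℂ))
    (hdim : Module.finrank ℂ Q = Fintype.card F ^ k)
    (hB : ∀ w : (Fin c → F) × (Fin c → F), w ≠ 0 → ∀ f ∈ Q, ∀ h ∈ Q,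
      star f ⬝ᵥ (pauli p (joinLabels p F A (Fin c) (0, w)).1
        (joinLabels p F A (Fin c) (0, w)).2 *ᵥ h) = 0) :
    IsEACodeSpace k c Q := by
  obtain ⟨f, hf, hspan⟩ := exists_orthonormal_family (J := Fin k → F) Q (by simpa using hdim)
  have hfQ : ∀ j, f j ∈ Q := fun j => hspan ▸ Submodule.subset_span ⟨j, rfl⟩
  set q : ℂ := (Fintype.card F : ℂ) ^ c with hq
  have hq0 : q ≠ 0 := by simp [hq]
  let r : ℂ := ((Real.sqrt ((Fintype.card F : ℝ) ^ c) : ℝ) : ℂ)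
  have hr : r * r = q := by
    simp only [r, hq, ← Complex.ofReal_mul]
    rw [Real.mul_self_sqrt (by positivity)]
    push_cast
    rfl
  have hr0 : r ≠ 0 := fun h => hq0 (by rw [← hr, h, zero_mul])
  -- the reduced states on Bob's side, up to transposition: multiples of the identity
  let R : (Fin k → F) → (Fin k → F) → (Fin c → F) → (Fin c → F) → ℂ := fun j j' y y' =>
    ∑ x : A → F, star (f j (Sum.elim x y)) * f j' (Sum.elim x y')
  have hsum : ∀ (j j' : Fin k → F) (w : (Fin c → F) × (Fin c → F)),
      star (f j) ⬝ᵥ (pauli p (joinLabels p F A (Fin c) (0, w)).1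
        (joinLabels p F A (Fin c) (0, w)).2 *ᵥ f j') =
      ∑ y, ZMod.stdAddChar (Algebra.trace (ZMod p) F (w.2 ⬝ᵥ y)) * R j j' (y + w.1) y := by
    intro j j' w
    rw [dotProduct, ← (Equiv.sumArrowEquivProdArrow A (Fin c) F).symm.sum_comp,
      Fintype.sum_prod_type_right]
    refine (Fintype.sum_equiv (Equiv.addRight w.1) _ _ fun y => ?_).symm
    simp only [R, Finset.mul_sum]
    refine Finset.sum_congr rfl fun x _ => ?_
    have h1 : ∀ y : Fin c → F, (Equiv.sumArrowEquivProdArrow A (Fin c) F).symm (x, y) =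
      Sum.elim x y := fun y => rfl
    have h2 : Sum.elim x (y + w.1) - Sum.elim (0 : A → F) w.1 = Sum.elim x y := by
      ext (i | i) <;> simp
    rw [pauli_mulVec, h1, Equiv.coe_addRight, joinLabels_apply]
    simp only [Prod.fst_zero, Prod.snd_zero, h2, sumElim_dotProduct_sumElim,
      zero_dotProduct, zero_add, Pi.star_apply]
    ring
  have hR : ∀ j j' y y', q * R j j' y y' = if (j, y) = (j', y') then 1 else 0 := by
    intro j j' y y'
    have h1 := sum_stdAddChar_mul_sum_stdAddChar (p := p) (fun x => R j j' (x + (y - y')) x) y'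
    rw [Fintype.card_fin, ← hq, add_sub_cancel] at h1
    rw [← h1]
    have h2 : ∀ b : Fin c → F, ∑ x, ZMod.stdAddChar (Algebra.trace (ZMod p) F (b ⬝ᵥ x)) *
        R j j' (x + (y - y')) x = if (j, y) = (j', y') ∧ b = 0 then 1 else 0 := by
      intro b
      rw [← hsum j j' (y - y', b)]
      by_cases h0 : ((y - y', b) : (Fin c → F) × (Fin c → F)) = 0
      · have hy : y = y' := sub_eq_zero.1 (congr_arg Prod.fst h0)
        have hb : b = 0 := congr_arg Prod.snd h0
        rw [h0, ← Prod.zero_eq_mk, map_zero, Prod.fst_zero, Prod.snd_zero, pauli_zero,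
          Matrix.one_mulVec, hf]
        simp [hy, hb]
      · rw [hB _ h0 _ (hfQ j) _ (hfQ j'), if_neg]
        rintro ⟨h, rfl⟩
        exact h0 (by simp [show y = y' from (Prod.ext_iff.1 h).2])
    simp only [h2]
    rw [Finset.sum_eq_single 0]
    · simp
    · intro b _ hb
      simp [hb]
    · simp
  refine ⟨Matrix.of fun x jy => r * f jy.1 (Sum.elim x jy.2), ?_, ?_⟩
  · ext ⟨j, y⟩ ⟨j', y'⟩
    rw [Matrix.one_apply, ← hR, ← hr]
    simp only [Matrix.mul_apply, Matrix.conjTranspose_apply, Matrix.of_apply, R, Finset.mul_sum]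
    refine Finset.sum_congr rfl fun x _ => ?_
    have : star r = r := Complex.conj_ofReal _
    rw [star_mul', this]
    ring
  · rw [Matrix.range_mulVecLin, ← hspan]
    congr 1
    congr 1
    funext j x
    simp only [encoder, Matrix.col_apply, Matrix.of_apply]
    rw [Sum.elim_comp_inl_inr]
    exact (inv_mul_cancel_left₀ hr0 _).symm

end EntanglementAssisted

section EntanglementAssistedExistence

variable {p : ℕ} [Fact p.Prime] {F : Type*} [Field F] [Fintype F]
  [Algebra (ZMod p) F] {A : Type*} [Fintype A]

theorem sympForm_nondegenerate : (sympForm p F A).Nondegenerate := by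
  refine ⟨fun v h => ?_, fun v h => ?_⟩ <;> by_contra hv <;>
    obtain ⟨w, hw⟩ := exists_sympForm_ne_zero (p := p) hv
  · exact hw (h w)
  · exact hw (sympForm_isAlt.eq_iff.1 (h w))

theorem finrank_labels : Module.finrank (ZMod p) ((A → F) × (A → F)) =
    Module.finrank (ZMod p) F * (2 * Fintype.card A) := by
  rw [Module.finrank_prod, Module.finrank_pi_fintype, Finset.sum_const, Finset.card_univ,
    smul_eq_mul]
  ring

theorem finrank_eq_of_natCard_eq {V : Type*} [AddCommGroup V] [Module (ZMod p) V] [Finite V]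
    {t : ℕ} (h : Nat.card V = Fintype.card F ^ t) :
    Module.finrank (ZMod p) V = Module.finrank (ZMod p) F * t := by
  have hF : Fintype.card F = p ^ Module.finrank (ZMod p) F := by
    rw [← Nat.card_eq_fintype_card, Module.natCard_eq_pow_finrank (K := ZMod p), Nat.card_zmod]
  rw [Module.natCard_eq_pow_finrank (K := ZMod p), Nat.card_zmod, hF, ← pow_mul] at h
  exact Nat.pow_right_injective (Fact.out : p.Prime).two_le h

variable [DecidableEq F] [DecidableEq A]

open scoped ComplexOrder in
theorem eq_zero_of_star_dotProduct_self {ι : Type*} [Fintype ι] {f : ι → ℂ}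
    (h : star f ⬝ᵥ f = 0) : f = 0 :=
  dotProduct_star_self_eq_zero.1 h

/-- Let `S` be the orthogonal complement of the additive code `M`. The radical of `S` is that of
`M`, so its quotient `S / rad S` is a symplectic space. It is isometric, up to sign, to the space of
labels of Pauli operators on `c` qudits. The graph of `S → S / rad S` is then an isotropic space of
labels of Alice and Bob. The errors that the resulting code does not detect are those
in `M` outside the radical. -/
theorem exists_entanglementAssisted {l k : ℕ} (M : Submodule (ZMod p) ((A → F) × (A → F)))
    (hM : Nat.card M = Fintype.card F ^ (l + 2 * k))
    (hR : Nat.card (M ⊓ (sympForm p F A).orthogonal M : Submodule _ _) = Fintype.card F ^ l) :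
    ∃ c, c + l + k = Fintype.card A ∧ ∃ Q : Submodule ℂ ((A ⊕ Fin c → F) → ℂ),
      IsEACodeSpace k c Q ∧
      IsEAStabilizer p ((sympForm p F A).orthogonal M).toAddSubgroup Q ∧
      ∀ v : (A → F) × (A → F),
        ¬ Detects p Q v.1 v.2 ↔ v ∈ M ∧ v ∉ (sympForm p F A).orthogonal M := by
  set S := (sympForm p F A).orthogonal M with hS
  set e := Module.finrank (ZMod p) F with he
  have hepos : 0 < e := Module.finrank_pos
  have hSM : (sympForm p F A).orthogonal S = M :=
    LinearMap.BilinForm.orthogonal_orthogonal sympForm_nondegenerate sympForm_isAlt.isRefl M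
  have hfM : Module.finrank (ZMod p) M = e * (l + 2 * k) := finrank_eq_of_natCard_eq hM
  have hfR : Module.finrank (ZMod p) (M ⊓ S : Submodule _ _) = e * l := finrank_eq_of_natCard_eq hR
  have hfS : Module.finrank (ZMod p) S + e * (l + 2 * k) = e * (2 * Fintype.card A) := by
    rw [← finrank_labels (p := p), ← hfM, hS,
      LinearMap.BilinForm.finrank_orthogonal sympForm_nondegenerate]
    exact Nat.sub_add_cancel (Submodule.finrank_le M)
  have hfRS : e * l ≤ Module.finrank (ZMod p) S := hfR ▸ Submodule.finrank_mono inf_le_right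
  -- the radical lies in `S`, and comparing dimensions gives `l + k ≤ |A|`
  obtain ⟨c, hc⟩ : ∃ c, c + l + k = Fintype.card A := by
    have h1 : e * (l + (l + 2 * k)) ≤ e * (2 * Fintype.card A) := by
      rw [mul_add]; omega
    have h2 := Nat.le_of_mul_le_mul_left h1 hepos
    exact ⟨Fintype.card A - l - k, by omega⟩
  refine ⟨c, hc, ?_⟩
  -- the form on `S` has radical `M ⊓ S` and hence rank `2 c e`
  let BS : LinearMap.BilinForm (ZMod p) S := (sympForm p F A).restrict S
  have hBS : ∀ x y : S, BS x y = sympForm p F A x y := fun x y => rfl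
  have hkerS : (LinearMap.ker BS).map S.subtype = M ⊓ S := by
    ext v
    simp only [Submodule.mem_map, LinearMap.mem_ker, Submodule.subtype_apply, Submodule.mem_inf]
    constructor
    · rintro ⟨x, hx, rfl⟩
      refine ⟨?_, x.2⟩
      rw [← hSM]
      intro y hy
      have h1 : BS x ⟨y, hy⟩ = 0 := by rw [hx]; rfl
      exact sympForm_isAlt.eq_iff.1 h1
    · rintro ⟨hvM, hvS⟩
      exact ⟨⟨v, hvS⟩, LinearMap.ext fun y => y.2 v hvM, rfl⟩
  have hfker : Module.finrank (ZMod p) (LinearMap.ker BS) = e * l := by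
    rw [← hfR, ← hkerS, Submodule.finrank_map_subtype_eq]
  obtain ⟨τ, hτ, hτB⟩ := exists_surjective_antiisometry BS (fun x => sympForm_isAlt x.1)
    (sympForm p F (Fin c)) sympForm_isAlt ker_sympForm (by
      rw [hfker, finrank_labels, Fintype.card_fin, ← he]
      have h1 : e * (2 * Fintype.card A) = e * (2 * c) + e * l + e * (l + 2 * k) := by
        rw [← hc]; ring
      omega)
  let j : S →ₗ[ZMod p] (A ⊕ Fin c → F) × (A ⊕ Fin c → F) :=
    joinLabels p F A (Fin c) ∘ₗ S.subtype.prod τ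
  have hj : ∀ x : S, j x = joinLabels p F A (Fin c) (x, τ x) := fun x => rfl
  have hjinj : Function.Injective j := fun x y h => Subtype.ext (joinLabels_left_injective (p := p) h)
  have hjmem : ∀ x, j x ∈ LinearMap.range j := fun x => ⟨x, rfl⟩
  obtain ⟨T, Q, hT, hQ, hlabel, hdim, hscal⟩ := exists_stabilizer (LinearMap.range j) (by
    rintro _ ⟨x, rfl⟩ _ ⟨y, rfl⟩
    rw [hj, hj, sympForm_joinLabels, hτB, hBS, add_neg_cancel])
  have hjx : ∀ (x : S) (v : (A → F) × (A → F)) (w : (Fin c → F) × (Fin c → F)),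
      sympForm p F (A ⊕ Fin c) (j x) (joinLabels p F A (Fin c) (v, w)) =
        sympForm p F A x v + sympForm p F (Fin c) (τ x) w := fun x v w => sympForm_joinLabels _ _ _ _
  -- operators whose labels are not orthogonal to some `j x` have zero matrix coefficients on `Q`
  have horth : ∀ (x : S) (v : (A → F) × (A → F)) (w : (Fin c → F) × (Fin c → F)),
      sympForm p F A x v + sympForm p F (Fin c) (τ x) w ≠ 0 → ∀ f ∈ Q, ∀ h ∈ Q,
      star f ⬝ᵥ (pauli p (joinLabels p F A (Fin c) (v, w)).1
        (joinLabels p F A (Fin c) (v, w)).2 *ᵥ h) = 0 := by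
    intro x v w hx f hf h hh
    obtain ⟨g, hg, hgx⟩ := (hlabel (j x)).1 (hjmem x)
    exact dotProduct_pauli_eq_zero hQ hg hgx (by rwa [hjx]) hf hh
  have hfQ : Module.finrank ℂ Q = Fintype.card F ^ k := by
    have h1 : Nat.card (LinearMap.range j) = Nat.card S :=
      (Nat.card_congr (LinearEquiv.ofInjective j hjinj).toEquiv).symm
    have h2 : Nat.card S * Fintype.card F ^ (l + 2 * k) =
        Fintype.card F ^ (2 * Fintype.card A) := by
      have hF : Fintype.card F = p ^ e := by
        rw [← Nat.card_eq_fintype_card, Module.natCard_eq_pow_finrank (K := ZMod p),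
          Nat.card_zmod]
      rw [Module.natCard_eq_pow_finrank (K := ZMod p), Nat.card_zmod, hF, ← pow_mul, ← pow_mul,
        ← pow_add, hfS]
    have h3 : Fintype.card (A ⊕ Fin c) = 2 * c + l + k := by
      rw [Fintype.card_sum, Fintype.card_fin]; omega
    rw [h1, h3] at hdim
    refine Nat.eq_of_mul_eq_mul_right (Nat.card_pos (α := S)) ?_
    rw [hdim]
    refine Nat.eq_of_mul_eq_mul_right (pow_pos (Fintype.card_pos : 0 < Fintype.card F) (l + 2 * k)) ?_
    rw [mul_assoc, h2, ← pow_add, ← pow_add]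
    congr 1
    omega
  refine ⟨Q, ?_, ⟨T, hT, hQ, fun s => ⟨fun hs => ?_, ?_⟩⟩, fun v => ?_⟩
  · refine isEACodeSpace_of_forall_dotProduct_eq_zero (p := p) Q hfQ fun w hw => ?_
    obtain ⟨u, hu⟩ := exists_sympForm_ne_zero (p := p) hw
    obtain ⟨x, rfl⟩ := hτ u
    exact horth x 0 w (by
      rw [map_zero, zero_add]
      exact fun h => hu (sympForm_isAlt.eq_iff.1 h))
  · obtain ⟨g, hg, hgx⟩ := (hlabel (j ⟨s, hs⟩)).1 (hjmem _)
    exact ⟨g, hg, _, _, hgx, rfl⟩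
  · rintro ⟨g, hg, a, b, hgab, rfl⟩
    obtain ⟨x, hx⟩ := (hlabel (a, b)).2 ⟨g, hg, hgab⟩
    have : x.1 = (a ∘ Sum.inl, b ∘ Sum.inl) := by
      rw [show a = (j x).1 by rw [hx], show b = (j x).2 by rw [hx]]
      rfl
    rw [← this]
    exact x.2
  · set P := pauli p (Sum.elim v.1 (0 : Fin c → F)) (Sum.elim v.2 (0 : Fin c → F)) with hP
    have hPj : P = pauli p (joinLabels p F A (Fin c) (v, 0)).1
        (joinLabels p F A (Fin c) (v, 0)).2 := rfl
    constructor
    -- if `v` is not in `M`, the matrix coefficients vanish; if it is in the radical, they are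
    -- those of a scalar
    · intro hnd
      by_contra hv
      refine hnd ?_
      by_cases hvM : v ∈ M
      · have hvS : v ∈ S := by
          by_contra hvS
          exact hv ⟨hvM, hvS⟩
        -- `v` is in the radical, so that `(v, 0)` is the label of an element of the stabilizer
        have hτv : τ ⟨v, hvS⟩ = 0 := by
          by_contra h0
          obtain ⟨u, hu⟩ := exists_sympForm_ne_zero (p := p) h0
          obtain ⟨y, rfl⟩ := hτ u
          exact hu (by rw [hτB, hBS, neg_eq_zero]; exact y.2 v hvM)
        have hjv : j ⟨v, hvS⟩ = joinLabels p F A (Fin c) (v, 0) := by rw [hj, hτv]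
        obtain ⟨g, hg, z, hz, hgz⟩ := (hlabel _).1 (hjmem ⟨v, hvS⟩)
        rw [hjv, ← hPj] at hgz
        have hz0 : z ≠ 0 := norm_ne_zero_iff.1 (by rw [hz]; exact one_ne_zero)
        refine ⟨z⁻¹, fun f _ h hh => ?_⟩
        have h1 : P *ᵥ h = z⁻¹ • h := by
          conv_rhs => rw [← (hQ h).1 hh g hg, hgz, Matrix.smul_mulVec, smul_smul,
            inv_mul_cancel₀ hz0, one_smul]
        rw [← hP, h1, dotProduct_smul, smul_eq_mul]
      · rw [← hSM] at hvM
        simp only [LinearMap.BilinForm.mem_orthogonal_iff, not_forall] at hvM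
        obtain ⟨x, hxS, hx⟩ := hvM
        refine ⟨0, fun f hf h hh => ?_⟩
        rw [zero_mul]
        exact horth ⟨x, hxS⟩ v 0 (by rwa [map_zero, add_zero]) f hf h hh
    · rintro ⟨hvM, hvS⟩ ⟨z, hz⟩
      -- the error preserves `Q`, so that detection would make it act on `Q` as a scalar
      have hPQ : ∀ f ∈ Q, P *ᵥ f ∈ Q := by
        intro f hf
        refine (hQ _).2 fun g hg => ?_
        obtain ⟨a, b, hgab⟩ := hT.1 g hg
        obtain ⟨x, hx⟩ := (hlabel (a, b)).2 ⟨g, hg, hgab⟩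
        obtain ⟨y, -, hgy⟩ := hgab
        have h0 : sympForm p F (A ⊕ Fin c) (joinLabels p F A (Fin c) (v, 0)) (a, b) = 0 := by
          refine sympForm_isAlt.eq_iff.1 ?_
          rw [← hx, hjx, map_zero, add_zero]
          exact sympForm_isAlt.eq_iff.1 (x.2 v hvM)
        have h1 : g.val * P = P * g.val := by
          rw [hgy, Matrix.smul_mul, Matrix.mul_smul, hPj, pauli_comm (a, b), h0,
            AddChar.map_zero_eq_one, one_smul]
        rw [Matrix.mulVec_mulVec, h1, ← Matrix.mulVec_mulVec, (hQ f).1 hf g hg]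
      have hPz : ∀ f ∈ Q, P *ᵥ f = z • f := by
        intro f hf
        have hd : P *ᵥ f - z • f ∈ Q := Q.sub_mem (hPQ f hf) (Q.smul_mem z hf)
        have h1 := hz _ hd f hf
        rw [← hP, ← smul_eq_mul, ← dotProduct_smul, ← sub_eq_zero, ← dotProduct_sub] at h1
        exact sub_eq_zero.1 (eq_zero_of_star_dotProduct_self h1)
      have hz0 : z ≠ 0 := by
        rintro rfl
        obtain ⟨f, hf, hf0⟩ := Q.ne_bot_iff.1 (fun h => by
          rw [h, finrank_bot] at hfQ
          exact (pow_pos (Fintype.card_pos : 0 < Fintype.card F) k).ne hfQ)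
        have h1 : Pᴴ *ᵥ (P *ᵥ f) = f := by
          rw [Matrix.mulVec_mulVec, conjTranspose_pauli_mul_pauli, Matrix.one_mulVec]
        rw [hPz f hf, zero_smul, Matrix.mulVec_zero] at h1
        exact hf0 h1.symm
      refine hscal (joinLabels p F A (Fin c) (v, 0)) ?_ z hz0 hPz
      rintro ⟨x, hx⟩
      exact hvS (joinLabels_left_injective (p := p) hx ▸ x.2)

end EntanglementAssistedExistence

/-! ### The trace form on codes over the quadratic extension -/

section TraceForm

variable {q : ℕ} {F K : Type*} [Field F] [Field K]
  [Algebra F K] {A : Type*}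

theorem codeMap_apply_eq_zero_iff {β : K} (hβ : LinearIndependent F ![β, β ^ q])
    (x : (A → F) × (A → F)) (i : A) :
    codeMap A q β x i = 0 ↔ x.1 i = 0 ∧ x.2 i = 0 := by
  rw [LinearIndependent.pair_iff] at hβ
  constructor
  · intro h
    exact hβ _ _ (by simpa [codeMap, Algebra.smul_def, mul_comm] using h)
  · rintro ⟨h1, h2⟩
    simp [codeMap, h1, h2]

theorem codeMap_injective {β : K} (hβ : LinearIndependent F ![β, β ^ q]) :
    Function.Injective (codeMap (F := F) A q β) := by
  rw [injective_iff_map_eq_zero]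
  intro x hx
  have h : ∀ i, x.1 i = 0 ∧ x.2 i = 0 := fun i =>
    (codeMap_apply_eq_zero_iff hβ x i).1 (congr_fun hx i)
  exact Prod.ext (funext fun i => (h i).1) (funext fun i => (h i).2)

theorem hammingNorm_codeMap [Fintype A] [DecidableEq F] [DecidableEq K] {β : K}
    (hβ : LinearIndependent F ![β, β ^ q]) (x : (A → F) × (A → F)) :
    hammingNorm (codeMap A q β x) = pauliWeight x.1 x.2 := by
  rw [hammingNorm, pauliWeight]
  congr 1
  ext i
  simp only [Finset.mem_filter, Finset.mem_univ, true_and, Ne, codeMap_apply_eq_zero_iff hβ]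
  tauto

variable [Fintype F] [Fintype K]

theorem finrank_eq_two (hF : Fintype.card F = q) (hK : Fintype.card K = q ^ 2) :
    Module.finrank F K = 2 := by
  have h := Module.card_eq_pow_finrank (K := F) (V := K)
  rw [hF, hK] at h
  have hq : 1 < q := hF ▸ Fintype.one_lt_card
  exact (Nat.pow_right_injective hq h).symm

theorem algebraMap_trace_quadratic (hF : Fintype.card F = q) (hK : Fintype.card K = q ^ 2)
    (x : K) : algebraMap F K (Algebra.trace F K x) = x + x ^ q := by
  rw [FiniteField.algebraMap_trace_eq_sum_pow, finrank_eq_two hF hK, Nat.card_eq_fintype_card, hF]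
  simp [Finset.sum_range_succ]


variable [Fintype A]

theorem codeMap_bijective (hF : Fintype.card F = q) (hK : Fintype.card K = q ^ 2) {β : K}
    (hβ : LinearIndependent F ![β, β ^ q]) : Function.Bijective (codeMap (F := F) A q β) := by
  classical
  rw [Fintype.bijective_iff_injective_and_card]
  refine ⟨codeMap_injective hβ, ?_⟩
  rw [Fintype.card_prod, Fintype.card_fun, Fintype.card_fun, hF, hK]
  ring

variable {p : ℕ} [Fact p.Prime] [Algebra (ZMod p) F] [Algebra (ZMod p) K]

/-- The map `codeMap` is an isometry: as `γ ^ q = -γ`, the terms with `β ^ (q + 1)` have trace zero,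
and the coefficient of the others is `γ (β² - β^(2q)) = 1`. -/
theorem traceInner_codeMap (hF : Fintype.card F = q) (hK : Fintype.card K = q ^ 2) {β : K}
    (hβ : LinearIndependent F ![β, β ^ q]) (x y : (A → F) × (A → F)) :
    traceInner p q β (codeMap A q β x) (codeMap A q β y) = sympForm p F A x y := by
  have hqq : ∀ x : K, (x ^ q) ^ q = x := fun x => by
    rw [← pow_mul, ← sq, ← hK, FiniteField.pow_card]
  let σ : K →ₐ[F] K := FiniteField.frobeniusAlgHom F K
  have hσ : ∀ x, σ x = x ^ q := fun x => hF ▸ rfl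
  have hne : β ^ 2 - β ^ (2 * q) ≠ 0 := by
    intro h
    have h1 : (β - β ^ q) * (β + β ^ q) = 0 := by
      rw [← h, mul_comm 2 q, pow_mul]; ring
    rw [LinearIndependent.pair_iff] at hβ
    rcases mul_eq_zero.1 h1 with h2 | h2
    · have := (hβ 1 (-1) (by rw [one_smul, neg_smul, one_smul, ← sub_eq_add_neg, h2])).1
      exact one_ne_zero this
    · have := (hβ 1 1 (by rw [one_smul, one_smul, h2])).1
      exact one_ne_zero this
  set γ := (β ^ 2 - β ^ (2 * q))⁻¹ with hγ
  have hγβ : γ * (β ^ 2 - (β ^ q) ^ 2) = 1 := by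
    rw [← pow_mul, mul_comm q 2]; exact inv_mul_cancel₀ hne
  have hσβ : σ β = β ^ q := hσ β
  have hσβ' : σ (β ^ q) = β := by rw [hσ, hqq]
  have hγq : σ γ = -γ := by
    rw [hγ, map_inv₀, map_sub, mul_comm 2 q, pow_mul, map_pow, map_pow, hσβ, hσβ', ← inv_neg,
      neg_sub]
  have key : Algebra.trace F K (γ * hermInner q (codeMap A q β x) (codeMap A q β y)) =
      x.1 ⬝ᵥ y.2 - x.2 ⬝ᵥ y.1 := by
    rw [hermInner, Finset.mul_sum, map_sum, dotProduct, dotProduct, ← Finset.sum_sub_distrib]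
    refine Finset.sum_congr rfl fun i _ => (algebraMap F K).injective ?_
    rw [algebraMap_trace_quadratic hF hK, ← hσ, ← hσ]
    simp only [codeMap, AddMonoidHom.coe_mk, ZeroHom.coe_mk, map_mul, map_add, map_sub,
      AlgHom.commutes, hσβ, hσβ', hγq]
    linear_combination (algebraMap F K (x.1 i) * algebraMap F K (y.2 i) -
      algebraMap F K (x.2 i) * algebraMap F K (y.1 i)) * hγβ
  rw [traceInner, ← Algebra.trace_trace (S := F), key, sympForm_apply']

theorem traceInner_comm_eq_zero (hF : Fintype.card F = q) (hK : Fintype.card K = q ^ 2) {β : K}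
    (hβ : LinearIndependent F ![β, β ^ q]) {u v : A → K} (h : traceInner p q β u v = 0) :
    traceInner p q β v u = 0 := by
  obtain ⟨x, rfl⟩ := (codeMap_bijective hF hK hβ).2 u
  obtain ⟨y, rfl⟩ := (codeMap_bijective hF hK hβ).2 v
  rw [traceInner_codeMap hF hK hβ] at h ⊢
  exact sympForm_isAlt.eq_iff.1 h

end TraceForm

/-! ### Combining additive codes -/

section CombinedCode

variable {p q : ℕ} [Fact p.Prime] {K : Type*} [Field K] [Algebra (ZMod p) K]

variable (p) in
/-- The combination of the rows of a matrix with given coefficients in the prime field. -/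
def rowComb {R A : Type*} [Fintype R] (G : Matrix R A K) : (R → ZMod p) →ₗ[ZMod p] (A → K) :=
  Fintype.linearCombination (ZMod p) fun r => G r

theorem rowComb_apply {R A : Type*} [Fintype R] (G : Matrix R A K) (c : R → ZMod p) (i : A) :
    rowComb p G c i = ∑ r, c r • G r i := by
  simp [rowComb, Fintype.linearCombination_apply]

theorem mem_rowCode_iff {R A : Type*} [Fintype R] (G : Matrix R A K) (u : A → K) :
    u ∈ rowCode G ↔ ∃ c : R → ZMod p, rowComb p G c = u := by
  have h : AddSubgroup.toZModSubmodule p (rowCode G) = LinearMap.range (rowComb p G) := by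
    rw [rowComb, Fintype.range_linearCombination]
    refine le_antisymm ?_ (Submodule.span_le.2 AddSubgroup.subset_closure)
    have h1 : rowCode G ≤
        (Submodule.span (ZMod p) (Set.range fun r => G r)).toAddSubgroup :=
      (AddSubgroup.closure_le _).2 Submodule.subset_span
    exact h1
  rw [← AddSubgroup.mem_toZModSubmodule p, h]
  rfl

theorem IsGeneratorMatrix.mem_iff {R A : Type*} [Fintype R] {G : Matrix R A K}
    {C : AddSubgroup (A → K)} (h : IsGeneratorMatrix p G C) (u : A → K) :
    u ∈ C ↔ ∃ c : R → ZMod p, rowComb p G c = u := by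
  rw [← h.2, mem_rowCode_iff (p := p)]

theorem IsGeneratorMatrix.injective {R A : Type*} [Fintype R] {G : Matrix R A K}
    {C : AddSubgroup (A → K)} (h : IsGeneratorMatrix p G C) :
    Function.Injective (rowComb p G) :=
  linearIndependent_iff_injective_fintypeLinearCombination.1 h.1

theorem IsGeneratorMatrix.natCard_eq {R A : Type*} [Fintype R] {G : Matrix R A K}
    {C : AddSubgroup (A → K)} (h : IsGeneratorMatrix p G C) :
    Nat.card (R → ZMod p) = Nat.card C := by
  rw [← Nat.card_range_of_injective h.injective]
  exact congr_arg (fun S : Set (A → K) => Nat.card S) (Set.ext fun u => (h.mem_iff u).symm)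

theorem linearCombination_fromCols {R A B : Type*} [Fintype R] (G : Matrix R A K)
    (H : Matrix R B K) (c : R → ZMod p) :
    rowComb p (Matrix.fromCols G H) c =
      Sum.elim (rowComb p G c)
        (rowComb p H c) := by
  ext (i | i) <;> simp [rowComb_apply]

theorem mem_rowCode_fromBlocks_iff {R S A B : Type*} [Fintype R] [Fintype S]
    {G : Matrix R A K} {C : AddSubgroup (A → K)} (hG : IsGeneratorMatrix p G C)
    (G' : Matrix S A K) (H : Matrix S B K) (u : A ⊕ B → K) :
    u ∈ rowCode (Matrix.fromBlocks G 0 G' H) ↔ ∃ x ∈ C, ∃ c : S → ZMod p,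
      Sum.elim (x + rowComb p G' c)
        (rowComb p H c) = u := by
  have hsum : ∀ (a : R → ZMod p) (c : S → ZMod p),
      rowComb p (Matrix.fromBlocks G 0 G' H) (Sum.elim a c) =
        Sum.elim (rowComb p G a + rowComb p G' c)
        (rowComb p H c) := by
    intro a c
    ext (i | i) <;> simp [rowComb_apply]
  rw [mem_rowCode_iff (p := p)]
  constructor
  · rintro ⟨a, rfl⟩
    refine ⟨_, (hG.mem_iff _).2 ⟨a ∘ Sum.inl, rfl⟩, a ∘ Sum.inr, ?_⟩
    rw [← hsum, Sum.elim_comp_inl_inr]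
  · rintro ⟨x, hx, c, rfl⟩
    obtain ⟨a, rfl⟩ := (hG.mem_iff x).1 hx
    exact ⟨Sum.elim a c, hsum a c⟩

theorem traceInner_add_left {A : Type*} [Fintype A] (β : K) (u u' v : A → K) :
    traceInner p q β (u + u') v = traceInner p q β u v + traceInner p q β u' v := by
  simp only [traceInner, hermInner, Pi.add_apply, add_mul, Finset.sum_add_distrib, mul_add,
    map_add]

theorem traceInner_zero_left {A : Type*} [Fintype A] (β : K) (v : A → K) :
    traceInner p q β 0 v = 0 := by
  simp [traceInner, hermInner]

theorem traceInner_sumElim {A B : Type*} [Fintype A] [Fintype B] (β : K) (u u' : A → K)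
    (v v' : B → K) :
    traceInner p q β (Sum.elim u v) (Sum.elim u' v') =
      traceInner p q β u u' + traceInner p q β v v' := by
  simp only [traceInner, hermInner, Fintype.sum_sum_type, Sum.elim_inl, Sum.elim_inr, mul_add,
    map_add]

theorem hammingNorm_sumElim [DecidableEq K] {A B : Type*} [Fintype A] [Fintype B] (u : A → K)
    (v : B → K) : hammingNorm (Sum.elim u v) = hammingNorm u + hammingNorm v := by
  simp only [hammingNorm, Finset.card_filter, Fintype.sum_sum_type, Sum.elim_inl, Sum.elim_inr]
  rfl

variable {F : Type*} [Field F] [Algebra F K] [Fintype F] [Fintype K] [Algebra (ZMod p) F]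

/-- A code word of the combined code lies in the radical exactly if only rows of `(G | 0)`
contribute to it. -/
theorem mem_traceDual_fromBlocks_iff (hF : Fintype.card F = q) (hK : Fintype.card K = q ^ 2)
    {β : K} (hβ : LinearIndependent F ![β, β ^ q])
    {R S A B : Type*} [Fintype R] [Fintype S] [Fintype A] [Fintype B]
    {C C' : AddSubgroup (A → K)} {E : AddSubgroup (B → K)}
    {G : Matrix R A K} {G' : Matrix S A K} {H : Matrix S B K}
    (hG : IsGeneratorMatrix p G C) (hG' : IsGeneratorMatrix p G' C')
    (hH : IsGeneratorMatrix p H E) (hDC : C ⊔ C' ≤ traceDual p q β C)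
    (hACD : IsACD p q β (rowCode (Matrix.fromCols G' H)))
    {x : A → K} (hx : x ∈ C) (c : S → ZMod p) :
    Sum.elim (x + rowComb p G' c)
        (rowComb p H c) ∈
      traceDual p q β (rowCode (Matrix.fromBlocks G 0 G' H)) ↔ c = 0 := by
  -- `(x | 0)` is orthogonal to the combined code
  have hortho : ∀ x' ∈ C, ∀ d : S → ZMod p,
      traceInner p q β x (x' + rowComb p G' d) = 0 := by
    intro x' hx' d
    have h1 : x' + rowComb p G' d ∈ C ⊔ C' :=
      (C ⊔ C').add_mem (AddSubgroup.mem_sup_left hx')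
        (AddSubgroup.mem_sup_right ((hG'.mem_iff _).2 ⟨d, rfl⟩))
    exact traceInner_comm_eq_zero hF hK hβ (hDC h1 x hx)
  constructor
  · intro h
    have hw : Sum.elim (rowComb p G' c)
        (rowComb p H c) ∈ rowCode (Matrix.fromCols G' H) ⊓
          traceDual p q β (rowCode (Matrix.fromCols G' H)) := by
      refine ⟨(mem_rowCode_iff (p := p) _ _).2 ⟨c, linearCombination_fromCols _ _ _⟩, ?_⟩
      intro v hv
      obtain ⟨d, rfl⟩ := (mem_rowCode_iff (p := p) _ _).1 hv
      rw [linearCombination_fromCols]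
      have h1 := h _ ((mem_rowCode_fromBlocks_iff hG G' H _).2 ⟨0, C.zero_mem, d, rfl⟩)
      rw [traceInner_sumElim, traceInner_add_left, hortho 0 C.zero_mem d, zero_add, zero_add] at h1
      rw [traceInner_sumElim, h1]
    rw [hACD, AddSubgroup.mem_bot] at hw
    refine hH.injective ?_
    rw [map_zero]
    funext i
    exact congr_fun hw (Sum.inr i)
  · rintro rfl v hv
    obtain ⟨x', hx', d, rfl⟩ := (mem_rowCode_fromBlocks_iff hG G' H v).1 hv
    rw [map_zero, map_zero, add_zero, traceInner_sumElim, hortho x' hx' d, traceInner_zero_left,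
      add_zero]

end CombinedCode

theorem mainTheorem2 {p q : ℕ} [Fact p.Prime]
    {F K : Type*} [Field F] [Fintype F] [DecidableEq F] [Field K] [Fintype K] [DecidableEq K]
    [Algebra F K] [Algebra (ZMod p) F] [Algebra (ZMod p) K]
    (hF : Fintype.card F = q) (hK : Fintype.card K = q ^ 2)
    (β : K) (hβ : LinearIndependent F ![β, β ^ q])
    {n m l k d₁ d₂ r s : ℕ}
    (C C' : AddSubgroup (Fin n → K)) (E : AddSubgroup (Fin m → K))
    (G : Matrix (Fin r) (Fin n) K) (G' : Matrix (Fin s) (Fin n) K) (H : Matrix (Fin s) (Fin m) K)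
    (hG : IsGeneratorMatrix p G C) (hG' : IsGeneratorMatrix p G' C')
    (hH : IsGeneratorMatrix p H E)
    (hC : Nat.card C = q ^ l) (hC' : Nat.card C' = q ^ (2 * k)) (hE : Nat.card E = q ^ (2 * k))
    (hD : Nat.card (C ⊔ C' : AddSubgroup (Fin n → K)) = q ^ (l + 2 * k))
    (hd₁ : HasMinDist (C ⊔ C') d₁) (hd₂ : HasMinDist E d₂)
    (hCD : C ≤ C ⊔ C') (hDC : C ⊔ C' ≤ traceDual p q β C)
    (hACD : IsACD p q β (rowCode (Matrix.fromCols G' H))) :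
    ∃ c d : ℕ, (c : ℤ) = n + m - l - k ∧ d₁ + d₂ ≤ d ∧
      ExistsEAQECCNe (F := F) p (n + m) k d c
        ((traceDual p q β (rowCode (Matrix.fromBlocks G 0 G' H))).comap
          (codeMap (Fin n ⊕ Fin m) q β)) := by
  set M := rowCode (Matrix.fromBlocks G 0 G' H) with hMdef
  let φ := codeMap (F := F) (Fin n ⊕ Fin m) q β
  have hφ : Function.Bijective φ := codeMap_bijective hF hK hβ
  let g' := rowComb p G'
  let h := rowComb p H
  have hmemM : ∀ u, u ∈ M ↔ ∃ x ∈ C, ∃ c : Fin s → ZMod p, Sum.elim (x + g' c) (h c) = u :=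
    mem_rowCode_fromBlocks_iff hG G' H
  have hrad : ∀ x ∈ C, ∀ c, Sum.elim (x + g' c) (h c) ∈ traceDual p q β M ↔ c = 0 :=
    fun x hx c => mem_traceDual_fromBlocks_iff hF hK hβ hG hG' hH hDC hACD hx c
  have hcardM : Nat.card M = q ^ (l + 2 * k) := by
    let f : C × (Fin s → ZMod p) → (Fin n ⊕ Fin m → K) := fun z =>
      Sum.elim (z.1.1 + g' z.2) (h z.2)
    have hf : Function.Injective f := by
      rintro ⟨x, c⟩ ⟨y, d⟩ hxy
      have h1 : c = d := hH.injective (funext fun i => congr_fun hxy (Sum.inr i))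
      subst h1
      have h2 : x.1 = y.1 := add_right_cancel (funext fun i => congr_fun hxy (Sum.inl i))
      rw [Subtype.ext h2]
    have hr : Set.range f = M := by
      ext u
      rw [SetLike.mem_coe, hmemM]
      constructor
      · rintro ⟨z, rfl⟩
        exact ⟨z.1, z.1.2, z.2, rfl⟩
      · rintro ⟨x, hx, c, rfl⟩
        exact ⟨(⟨x, hx⟩, c), rfl⟩
    have h1 := Nat.card_range_of_injective hf
    rw [hr, Nat.card_prod, hH.natCard_eq, hC, hE, ← pow_add] at h1
    exact h1
  have hcardR : Nat.card (M ⊓ traceDual p q β M : AddSubgroup _) = q ^ l := by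
    let f : C → (Fin n ⊕ Fin m → K) := fun x => Sum.elim x.1 0
    have hf : Function.Injective f := fun x y hxy =>
      Subtype.ext (funext fun i => congr_fun hxy (Sum.inl i))
    have hf' : ∀ x : C, f x = Sum.elim (x.1 + g' 0) (h 0) := fun x => by
      rw [map_zero, map_zero, add_zero]
    have hr : Set.range f = (M ⊓ traceDual p q β M : AddSubgroup _) := by
      ext u
      rw [SetLike.mem_coe, AddSubgroup.mem_inf]
      constructor
      · rintro ⟨x, rfl⟩
        rw [hf']
        exact ⟨(hmemM _).2 ⟨x, x.2, 0, rfl⟩, (hrad x x.2 0).2 rfl⟩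
      · rintro ⟨h1, h2⟩
        obtain ⟨x, hx, c, rfl⟩ := (hmemM u).1 h1
        rw [hrad x hx] at h2
        subst h2
        exact ⟨⟨x, hx⟩, hf' _⟩
    have h1 := Nat.card_range_of_injective hf
    rw [hr, hC] at h1
    exact h1
  -- `codeMap` carries the symplectic complement of `M₀` to the trace dual of `M`
  let M₀ := AddSubgroup.toZModSubmodule p (M.comap φ)
  have hperp : ∀ x, x ∈ (sympForm p F _).orthogonal M₀ ↔ φ x ∈ traceDual p q β M := by
    intro x
    constructor
    · intro hx v hv
      obtain ⟨y, rfl⟩ := hφ.2 v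
      rw [traceInner_codeMap hF hK hβ]
      exact sympForm_isAlt.eq_iff.1 (hx y hv)
    · intro hx y hy
      refine sympForm_isAlt.eq_iff.1 ?_
      rw [← traceInner_codeMap hF hK hβ]
      exact hx _ hy
  have hcomap : ∀ S : AddSubgroup (Fin n ⊕ Fin m → K), Nat.card (S.comap φ) = Nat.card S :=
    fun S => Nat.card_preimage_of_injective hφ.1 fun u _ => hφ.2 u
  obtain ⟨c, hc, Q, hQ, hQS, hdet⟩ := exists_entanglementAssisted (F := F) (l := l) (k := k) M₀
    (by rw [hF, ← hcardM]; exact hcomap M)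
    (by
      rw [hF, ← hcardR, ← hcomap]
      refine congr_arg (fun S : Set _ => Nat.card S) (Set.ext fun x => ?_)
      exact and_congr Iff.rfl (hperp x))
  have hS : ((sympForm p F _).orthogonal M₀).toAddSubgroup = (traceDual p q β M).comap φ :=
    AddSubgroup.ext hperp
  rw [hS] at hQS
  let W : Set ℕ := {w | ∃ a b : Fin n ⊕ Fin m → F, ¬ Detects p Q a b ∧ pauliWeight a b = w}
  have hW : W.Nonempty := by
    obtain ⟨y, hy, hy0, -⟩ := hd₂.1
    obtain ⟨a, ha⟩ := (hH.mem_iff y).1 hy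
    obtain ⟨v, hv⟩ := hφ.2 (Sum.elim (0 + g' a) (h a))
    refine ⟨_, v.1, v.2, (hdet v).2 ⟨?_, fun hv' => ?_⟩, rfl⟩
    · show φ v ∈ M
      rw [hv]
      exact (hmemM _).2 ⟨0, C.zero_mem, a, rfl⟩
    · rw [hperp, hv, hrad 0 C.zero_mem] at hv'
      rw [hv', map_zero] at ha
      exact hy0 ha.symm
  -- the sum of `C` and `C'` is direct
  have hdirect : ∀ x ∈ C, ∀ y ∈ C', x + y = 0 → y = 0 := by
    let f : C × C' → (C ⊔ C' : AddSubgroup (Fin n → K)) := fun z =>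
      ⟨z.1 + z.2, AddSubgroup.add_mem_sup z.1.2 z.2.2⟩
    have hf : Function.Surjective f := by
      rintro ⟨u, hu⟩
      obtain ⟨x, hx, y, hy, rfl⟩ := AddSubgroup.mem_sup.1 hu
      exact ⟨(⟨x, hx⟩, ⟨y, hy⟩), rfl⟩
    have hf' := hf.bijective_of_nat_card_le (by rw [Nat.card_prod, hC, hC', hD, pow_add])
    intro x hx y hy hxy
    have h1 : f (⟨x, hx⟩, ⟨y, hy⟩) = f 0 := Subtype.ext (hxy.trans (add_zero 0).symm)
    exact congr_arg (fun z : C × C' => z.2.1) (hf'.1 h1)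
  have hdist : ∀ w ∈ W, d₁ + d₂ ≤ w := by
    rintro _ ⟨a, b, hab, rfl⟩
    obtain ⟨hM, hM'⟩ := (hdet (a, b)).1 hab
    obtain ⟨x, hx, e, he⟩ := (hmemM _).1 (show φ (a, b) ∈ M from hM)
    rw [hperp, ← he, hrad x hx] at hM'
    have hg'C : g' e ∈ C' := (hG'.mem_iff _).2 ⟨e, rfl⟩
    have hwt : pauliWeight a b = hammingNorm (φ (a, b)) := (hammingNorm_codeMap hβ (a, b)).symm
    rw [hwt, ← he, hammingNorm_sumElim]
    refine add_le_add (hd₁.2 ⟨_, AddSubgroup.add_mem_sup hx hg'C, fun h0 => hM' ?_, rfl⟩)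
      (hd₂.2 ⟨_, (hH.mem_iff _).2 ⟨e, rfl⟩, fun h0 => hM' ?_, rfl⟩)
    · exact hG'.injective ((hdirect x hx _ hg'C h0).trans (map_zero _).symm)
    · exact hH.injective (h0.trans (map_zero _).symm)
  have hlen : Fintype.card (Fin n ⊕ Fin m) = n + m := by simp
  refine ⟨c, sInf W, by omega, hdist _ (Nat.sInf_mem hW), Q,
    ⟨hlen, hQ, hQS, Nat.sInf_mem hW, fun w hw => Nat.sInf_le hw⟩,
    c, c, ⊤, isStabilizerCode_top c, le_rfl⟩
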